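/- Let $K$ be a field of characteristic $2$, $V$ a finite-dimensional $K$-vector space, and $Q$ a quadratic form on $V$ that is nondefective, i.e. its polar form $f_Q(u,w)=Q(u+w)-Q(u)-Q(w)$ is nondegenerate. Let $\mathrm{O}(V,Q)$ be the group of linear bijections of $V$ preserving $Q$; maps act on the right, so $\varphi\sigma$ means first $\varphi$, then $\sigma$. For $\varphi\in\mathrm{GL}(V)$ let $\mathrm{Fix}(\varphi)=\ker(\varphi-1)$. An involution is a $\sigma$ with $\sigma^2=1$ (the identity is allowed), and $\sigma$ inverts $\varphi$ if $\sigma^{-1}\varphi\sigma=\varphi^{-1}$. An element $\varphi\in\mathrm{O}(V,Q)$ is orthogonally indecomposable if $0$ and $V$ are the only $\varphi$-invariant subspaces $W$ of $V$ for which $Q|_W$ is nondefective. It is cyclic if $V$ is generated by a single vector as a $K[\varphi]$-module, and unipotent if $\varphi-1$ is nilpotent. An orthogonally indecomposable $\varphi$ is of type 1o if for some $m\ge 1$ it is bicyclic with elementary divisors $(x+1)^m,(x+1)^m$ (i.e. $V\cong K[x]/((x+1)^m)\oplus K[x]/((x+1)^m)$ as $K[x]$-modules, $x$ acting as $\varphi$),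 and its minimal polynomial has odd degree. It is of type 2 if $V\neq 0$ and $V$ is not the direct sum of two nonzero $\varphi$-invariant subspaces. **Proposition.** Let $\varphi\in\mathrm{O}(V,Q)$ be orthogonally indecomposable. Then: 1. $\varphi$ is inverted by an involution $\sigma\in\mathrm{O}(V,Q)$ with $\dim\mathrm{Fix}(\sigma)=\frac{\dim V}{2}$. 2. If $\varphi$ is cyclic and $\sigma\in\mathrm{O}(V,Q)$ is an involution inverting $\varphi$, then $\mathrm{Fix}(\varphi)=\mathrm{Fix}(\sigma)\cap\mathrm{Fix}(\varphi\sigma)$. 3. If $\varphi$ is of type 1o or of type 2, and $\varphi$ is unipotent, then $\varphi$ is inverted by involutions $\rho,\sigma\in\mathrm{O}(V,Q)$ with $\dim\mathrm{Fix}(\rho)=\frac{\dim V}{2}$ and $\dim\mathrm{Fix}(\sigma)=\frac{\dim V}{2}+1$. -/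

import Mathlib

open Polynomial

namespace QuadraticSpace

variable {K V : Type*} [Field K] [AddCommGroup V] [Module K V]

/-- `Q` is nondefective: its polar form `f(u, w) = Q (u + w) - Q u - Q w` is nondegenerate. -/
def IsNondefective (Q : QuadraticForm K V) : Prop :=
  Q.polarBilin.Nondegenerate

/-- The orthogonal group `O(V, Q)`, as a subgroup of `GL(V)`. -/
def orthogonalGroup (Q : QuadraticForm K V) : Subgroup (V ≃ₗ[K] V) where
  carrier := {φ | ∀ v, Q (φ v) = Q v}
  mul_mem' {φ ψ} hφ hψ v := (hφ (ψ v)).trans (hψ v)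
  one_mem' _ := rfl
  inv_mem' {φ} hφ v := by
    have h := hφ (φ.symm v)
    rw [LinearEquiv.apply_symm_apply] at h
    exact h.symm

/-- The fix space `Fix(φ)`, i.e. the kernel of `φ - 1`. -/
def fix (φ : V ≃ₗ[K] V) : Submodule K V :=
  LinearMap.ker ((φ : V →ₗ[K] V) - 1)

/-- `σ` is an involution: `σ² = 1` (the identity is allowed). -/
def IsInvolution (σ : V ≃ₗ[K] V) : Prop :=
  σ * σ = 1

/-- `σ` inverts `φ`: conjugating `φ` by `σ` gives `φ⁻¹`. -/
def Inverts (σ φ : V ≃ₗ[K] V) : Prop :=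
  σ⁻¹ * φ * σ = φ⁻¹

/-- The subspace `W` is invariant under `φ`. -/
def IsInvariant (φ : V ≃ₗ[K] V) (W : Submodule K V) : Prop :=
  ∀ w ∈ W, φ w ∈ W

/-- `φ` is unipotent: `φ - 1` is nilpotent. -/
def IsUnipotent (φ : V ≃ₗ[K] V) : Prop :=
  IsNilpotent ((φ : Module.End K V) - 1)

/-- `φ` is cyclic: some `v` generates `V` as a `K[φ]`-module. -/
def IsCyclic (φ : V ≃ₗ[K] V) : Prop :=
  ∃ v : V, Submodule.span K (Set.range fun k : ℕ => (φ ^ k) v) = ⊤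

/-- `φ` is indecomposable as a linear map: `V ≠ 0` is not the direct sum of two nonzero
`φ`-invariant subspaces. -/
def IsIndecomposable (φ : V ≃ₗ[K] V) : Prop :=
  Nontrivial V ∧ ∀ U W : Submodule K V,
    IsInvariant φ U → IsInvariant φ W → IsCompl U W → U = ⊥ ∨ W = ⊥

/-- `φ` is bicyclic with elementary divisors `p`, `p`: as a `K[X]`-module, with `X` acting as `φ`,
`V` is isomorphic to `K[X]/(p) × K[X]/(p)`. -/
def IsBicyclicWith (φ : V ≃ₗ[K] V) (p : K[X]) : Prop :=
  Nonempty (Module.AEval' (φ : Module.End K V) ≃ₗ[K[X]]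
    (K[X] ⧸ Ideal.span {p}) × (K[X] ⧸ Ideal.span {p}))

/-- `φ` is orthogonally indecomposable: `0` and `V` are the only `φ`-invariant subspaces on which
`Q` is nondefective. -/
def IsOrthIndecomposable (Q : QuadraticForm K V) (φ : V ≃ₗ[K] V) : Prop :=
  ∀ W : Submodule K V, IsInvariant φ W → IsNondefective (Q.restrict W) → W = ⊥ ∨ W = ⊤

/-- Type 1: orthogonally indecomposable, and bicyclic with elementary divisors
`(X ± 1)^m`, `(X ± 1)^m` for some `m ≥ 1`. -/
def IsType1 (Q : QuadraticForm K V) (φ : V ≃ₗ[K] V) : Prop :=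
  IsOrthIndecomposable Q φ ∧
    ∃ m : ℕ, 1 ≤ m ∧ (IsBicyclicWith φ ((X - 1) ^ m) ∨ IsBicyclicWith φ ((X + 1) ^ m))

/-- Type 1o: type 1 with minimal polynomial of odd degree. -/
def IsType1o (Q : QuadraticForm K V) (φ : V ≃ₗ[K] V) : Prop :=
  IsType1 Q φ ∧ Odd (minpoly K (φ : Module.End K V)).natDegree

/-- Type 2: orthogonally indecomposable, and indecomposable as a linear map. -/
def IsType2 (Q : QuadraticForm K V) (φ : V ≃ₗ[K] V) : Prop :=
  IsOrthIndecomposable Q φ ∧ IsIndecomposable φ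

end QuadraticSpace

namespace QuadraticSpace

open QuadraticMap Module

variable {K V : Type*} [Field K] [AddCommGroup V] [Module K V]

/-! ### Nondegenerate polar forms -/

/-! Write f for the polar form and N = φ - 1. Since f(φ^i v, v) = f(φ^(-i) v, v), reversing an
orbit, φ^i v ↦ φ^(a-i) v, preserves all Gram data. On a spanning family of orbits, with compatible
data between different orbits, such a map is an isometric involution inverting φ
(`exists_reversing_involution`). Its fix space has at least half the dimension because (σ - 1)² = 0
in characteristic 2. It is bounded above by counting basis vectors that the reflection of exponents
moves to other basis vectors. A fixed exponent yields a fixed vector outside range(φ - 1), hence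
outside range(σ - 1), which forces one extra dimension.

It remains to find few generating orbits. The map φ + φ⁻¹ is self-adjoint and commutes with φ, so by
Fitting's lemma and orthogonal indecomposability it is injective or nilpotent. If injective, φ is
cyclic (`isCyclic_of_injective_add_symm`). If nilpotent, φ is unipotent. With N^k the last nonzero
power of N, either f(N^k u, u) ≠ 0 for some u, and the orbit of u spans V, or f(N^k x, y) is
alternating and two orbits of length k + 1 span V (`isCyclic_or_alternating`, `span_pair`).

In the cyclic case the parity of a decides between dim/2 and dim/2 + 1. With two orbits, reversing
both gives dim/2 for k + 1 even and dim/2 + 1 for k + 1 odd (`exists_diagonal_involution`). For k +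
1 odd, dim/2 comes from exchanging the orbits of w and v + w, for a suitable pair v, w
(`exists_swap_involution`).

The fix space formula for cyclic φ holds because Fix(φ) is at most a line, on which an involution in
characteristic 2 acts trivially. -/

theorem IsNondefective.eq_zero_of_polar {Q : QuadraticForm K V} (hQ : IsNondefective Q) {x : V}
    (h : ∀ y, polar Q x y = 0) : x = 0 :=
  hQ.1 x h

theorem IsNondefective.of_polar {Q : QuadraticForm K V}
    (h : ∀ x, (∀ y, polar Q x y = 0) → x = 0) : IsNondefective Q :=
  ⟨h, fun y hy => h y fun x => (polar_comm _ _ _).trans (hy x)⟩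

theorem isNondefective_restrict {Q : QuadraticForm K V} {W : Submodule K V}
    (h : ∀ x ∈ W, (∀ y ∈ W, polar Q x y = 0) → x = 0) : IsNondefective (Q.restrict W) :=
  .of_polar fun x hx => Subtype.ext (h x x.2 fun y hy => hx ⟨y, hy⟩)

theorem polar_self_eq_zero [CharP K 2] (Q : QuadraticForm K V) (x : V) : polar Q x x = 0 := by
  rw [polar_self, ← Nat.cast_smul_eq_nsmul K, CharP.cast_eq_zero, zero_smul]

theorem add_self_eq_zero_of_char_two (K : Type*) [Field K] [CharP K 2] [Module K V] (x : V) :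
    x + x = 0 := by
  rw [← two_smul K, CharTwo.two_eq_zero, zero_smul]

/-- A linearly independent family can be paired with arbitrary values. -/
theorem IsNondefective.exists_polar_eq [FiniteDimensional K V] {Q : QuadraticForm K V}
    (hQ : IsNondefective Q) {ι : Type*} {e : ι → V} (he : LinearIndependent K e) (g : ι → K) :
    ∃ w, ∀ i, polar Q (e i) w = g i := by
  classical
  obtain ⟨l, hl⟩ : ∃ l : Dual K V, ∀ i, l (e i) = g i := by
    refine ⟨(Basis.extend he.linearIndepOn_id).constr K
      fun j => if h : ∃ i, e i = j then g h.choose else 0, fun i => ?_⟩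
    have hi : e i ∈ he.linearIndepOn_id.extend (Set.subset_univ _) :=
      Basis.subset_extend he.linearIndepOn_id ⟨i, rfl⟩
    have hb : Basis.extend he.linearIndepOn_id ⟨e i, hi⟩ = e i := by simp
    conv_lhs => rw [← hb]
    rw [Basis.constr_basis]
    have h : ∃ j, e j = e i := ⟨i, rfl⟩
    rw [dif_pos h, he.injective h.choose_spec]
  refine ⟨(LinearMap.BilinForm.toDual Q.polarBilin hQ).symm l, fun i => ?_⟩
  rw [polar_comm, ← hl i]
  exact LinearMap.BilinForm.apply_toDual_symm_apply (hB := hQ) l (e i)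

/-- A nondegenerate alternating space has even dimension. -/
theorem IsNondefective.even_finrank [CharP K 2] [FiniteDimensional K V] {Q : QuadraticForm K V}
    (hQ : IsNondefective Q) : Even (finrank K V) := by
  obtain ⟨U, hU, hmax⟩ := exists_maximal_of_wellFoundedGT
    (fun U : Submodule K V => ∀ x ∈ U, ∀ y ∈ U, polar Q x y = 0)
    ⟨⊥, fun x hx y _ => by rw [(Submodule.mem_bot K).1 hx, polar_zero_left]⟩
  have hle : U ≤ LinearMap.BilinForm.orthogonal Q.polarBilin U := fun x hx y hy => hU y hy x hx
  -- The polar form is alternating, so adjoining a vector orthogonal to `U` keeps the span totally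
  -- isotropic; maximality puts that vector in `U`.
  have hge : LinearMap.BilinForm.orthogonal Q.polarBilin U ≤ U := by
    intro x hx
    have h : U ≤ U ⊔ Submodule.span K {x} := le_sup_left
    refine hmax (y := U ⊔ Submodule.span K {x}) ?_ h (Submodule.mem_sup_right
      (Submodule.mem_span_singleton_self x))
    intro a ha b hb
    obtain ⟨a, ha', _, hc, rfl⟩ := Submodule.mem_sup.1 ha
    obtain ⟨b, hb', _, hd, rfl⟩ := Submodule.mem_sup.1 hb
    obtain ⟨c, rfl⟩ := Submodule.mem_span_singleton.1 hc
    obtain ⟨d, rfl⟩ := Submodule.mem_span_singleton.1 hd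
    have h1 : polar Q a x = 0 := hx a ha'
    have h2 : polar Q x b = 0 := (polar_comm _ _ _).trans (hx b hb')
    simp only [polar_add_left, polar_add_right, polar_smul_left, polar_smul_right, h1, h2,
      hU a ha' b hb', polar_self_eq_zero, smul_zero, add_zero]
  have := LinearMap.BilinForm.finrank_orthogonal hQ U
  have hle' := Submodule.finrank_le U
  rw [← le_antisymm hle hge] at this
  exact ⟨finrank K U, by omega⟩

/-! ### Isometries -/

theorem polar_map {Q : QuadraticForm K V} {φ : V ≃ₗ[K] V} (hφ : φ ∈ orthogonalGroup Q) (x y : V) :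
    polar Q (φ x) (φ y) = polar Q x y := by
  have h : ∀ v, Q (φ v) = Q v := hφ
  simp only [polar, ← map_add, h]

theorem polar_zpow {Q : QuadraticForm K V} {φ : V ≃ₗ[K] V} (hφ : φ ∈ orthogonalGroup Q)
    (i j : ℤ) (x y : V) : polar Q ((φ ^ i) x) ((φ ^ j) y) = polar Q ((φ ^ (i - j)) x) y := by
  rw [← polar_map (zpow_mem hφ j) ((φ ^ (i - j)) x), ← LinearEquiv.mul_apply, ← zpow_add,
    add_sub_cancel]

/-- Two spanning families with the same Gram data are related by an isometry. -/
theorem exists_isometry {Q : QuadraticForm K V} (hQ : IsNondefective Q) {ι : Type*} {e e' : ι → V}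
    (he : Submodule.span K (Set.range e) = ⊤) (he' : Submodule.span K (Set.range e') = ⊤)
    (hq : ∀ i, Q (e i) = Q (e' i)) (hf : ∀ i j, polar Q (e i) (e j) = polar Q (e' i) (e' j)) :
    ∃ σ ∈ orthogonalGroup Q, ∀ i, σ (e i) = e' i := by
  set L := Finsupp.linearCombination K e
  set L' := Finsupp.linearCombination K e'
  have hL : Function.Surjective L := by
    rw [← LinearMap.range_eq_top, Finsupp.range_linearCombination, he]
  have hL' : Function.Surjective L' := by
    rw [← LinearMap.range_eq_top, Finsupp.range_linearCombination, he']
  have hp : ∀ x y, polar Q (L x) (L y) = polar Q (L' x) (L' y) := by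
    have : Q.polarBilin.compl₁₂ L L = Q.polarBilin.compl₁₂ L' L' := by
      ext i j
      simpa [L, L'] using hf i j
    exact fun x y => congr($this x y)
  have hQL : ∀ x, Q (L x) = Q (L' x) := by
    intro x
    induction x using Finsupp.induction_linear with
    | zero => simp
    | add x y hx hy => rw [map_add L, map_add L', QuadraticMap.map_add Q (L x), hx, hy, hp,
        QuadraticMap.map_add Q (L' x)]
    | single i c => simp [L, L', QuadraticMap.map_smul, hq]
  -- By nondegeneracy and surjectivity, both kernels are the radical of the same pulled-back form.
  have hker : LinearMap.ker L = LinearMap.ker L' := by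
    ext x
    rw [LinearMap.mem_ker, LinearMap.mem_ker]
    constructor <;> intro h <;> refine hQ.eq_zero_of_polar fun y => ?_
    · obtain ⟨y, rfl⟩ := hL' y
      rw [← hp, h, polar_zero_left]
    · obtain ⟨y, rfl⟩ := hL y
      rw [hp, h, polar_zero_left]
  let σ : V ≃ₗ[K] V := (L.quotKerEquivOfSurjective hL).symm ≪≫ₗ
    Submodule.quotEquivOfEq _ _ hker ≪≫ₗ L'.quotKerEquivOfSurjective hL'
  have hσ : ∀ x, σ (L x) = L' x := by
    intro x
    have : (L.quotKerEquivOfSurjective hL).symm (L x) = Submodule.Quotient.mk x := by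
      rw [LinearEquiv.symm_apply_eq]; rfl
    simp only [σ, LinearEquiv.trans_apply, this]
    rfl
  refine ⟨σ, fun v => ?_, fun i => by simpa [L, L'] using hσ (Finsupp.single i 1)⟩
  obtain ⟨x, rfl⟩ := hL v
  rw [hσ, hQL]

theorem linearEquiv_ext_span {ι : Type*} {e : ι → V} (he : Submodule.span K (Set.range e) = ⊤)
    {σ τ : V ≃ₗ[K] V} (h : ∀ i, σ (e i) = τ (e i)) : σ = τ := by
  apply LinearEquiv.toLinearMap_injective
  exact LinearMap.ext_on_range he h

/-! ### Dimension of the fix space of an involution -/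

theorem mem_fix {σ : V ≃ₗ[K] V} {x : V} : x ∈ fix σ ↔ σ x = x := by
  rw [fix, LinearMap.mem_ker, LinearMap.sub_apply, sub_eq_zero]; rfl

theorem IsInvolution.apply_apply {σ : V ≃ₗ[K] V} (hσ : IsInvolution σ) (x : V) : σ (σ x) = x :=
  congr($hσ x)

theorem IsInvolution.range_le_fix [CharP K 2] {σ : V ≃ₗ[K] V} (hσ : IsInvolution σ) :
    LinearMap.range ((σ : V →ₗ[K] V) - 1) ≤ fix σ := by
  rintro _ ⟨x, rfl⟩
  rw [mem_fix]
  simp only [LinearMap.sub_apply, LinearEquiv.coe_coe, End.one_apply, map_sub, hσ.apply_apply]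
  rw [sub_eq_sub_iff_add_eq_add, add_self_eq_zero_of_char_two K, add_self_eq_zero_of_char_two K]

theorem IsInvolution.finrank_le [CharP K 2] [FiniteDimensional K V] {σ : V ≃ₗ[K] V}
    (hσ : IsInvolution σ) : finrank K V ≤ 2 * finrank K (fix σ) := by
  have h1 := LinearMap.finrank_range_add_finrank_ker ((σ : V →ₗ[K] V) - 1)
  have h2 := Submodule.finrank_mono hσ.range_le_fix
  rw [fix] at h2 ⊢
  omega

theorem IsInvolution.finrank_lt [CharP K 2] [FiniteDimensional K V] {σ : V ≃ₗ[K] V}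
    (hσ : IsInvolution σ) {u : V} (hu : σ u = u)
    (hu' : u ∉ LinearMap.range ((σ : V →ₗ[K] V) - 1)) : finrank K V < 2 * finrank K (fix σ) := by
  have h1 := LinearMap.finrank_range_add_finrank_ker ((σ : V →ₗ[K] V) - 1)
  have h2 := Submodule.finrank_lt_finrank_of_lt
    (lt_of_le_of_ne hσ.range_le_fix fun h => hu' (h ▸ mem_fix.2 hu))
  rw [fix] at h2 ⊢
  omega

theorem finrank_add_finrank_fix_le [FiniteDimensional K V] {σ : V ≃ₗ[K] V} {P P' : Submodule K V}
    (hP : ∀ x ∈ P, σ x ∈ P') (hd : Disjoint P P') :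
    finrank K P + finrank K (fix σ) ≤ finrank K V := by
  apply Submodule.finrank_add_finrank_le_of_disjoint
  rw [Submodule.disjoint_def] at hd ⊢
  exact fun x hx hx' => hd x hx (mem_fix.1 hx' ▸ hP x hx)

/-- If `σ` maps a part `S` of a linearly independent family into the rest, it moves at least
`#S` dimensions. -/
theorem card_add_finrank_fix_le [FiniteDimensional K V] {σ : V ≃ₗ[K] V} {ι : Type*} {e : ι → V}
    (he : LinearIndependent K e) (S : Finset ι)
    (hS : ∀ i ∈ S, ∃ j ∉ S, σ (e i) = e j) :
    S.card + finrank K (fix σ) ≤ finrank K V := by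
  classical
  have hd := he.disjoint_span_image (s := (S : Set ι)) (t := (S : Set ι)ᶜ) disjoint_compl_right
  have := finrank_add_finrank_fix_le (σ := σ) (fun x hx => ?_) hd
  · rwa [finrank_span_set_eq_card (he.linearIndepOn _).id_image, Set.toFinset_card,
      ← Set.toFinset_card, Set.toFinset_image, Finset.card_image_of_injective _ he.injective,
      Finset.toFinset_coe] at this
  · induction hx using Submodule.span_induction with
    | mem x hx =>
      obtain ⟨i, hi, rfl⟩ := hx
      obtain ⟨j, hj, h⟩ := hS i hi
      exact Submodule.subset_span ⟨j, hj, h.symm⟩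
    | zero => simp
    | add x y _ _ hx hy => rw [map_add]; exact add_mem hx hy
    | smul c x _ hx => rw [map_smul]; exact Submodule.smul_mem _ _ hx

/-! ### Involutions inverting an isometry -/

theorem inverts_iff {σ φ : V ≃ₗ[K] V} : Inverts σ φ ↔ φ * σ = σ * φ⁻¹ := by
  rw [Inverts, mul_assoc, inv_mul_eq_iff_eq_mul]

theorem zpow_apply_zpow_apply (φ : V ≃ₗ[K] V) (i j : ℤ) (x : V) :
    (φ ^ i) ((φ ^ j) x) = (φ ^ (i + j)) x := by
  rw [zpow_add]; rfl

/-- An involution that reverses the `φ`-orbits of a generating family and permutes them by `π`. -/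
theorem exists_reversing_involution {Q : QuadraticForm K V} (hQ : IsNondefective Q)
    {φ : V ≃ₗ[K] V} (hφ : φ ∈ orthogonalGroup Q) {κ : Type*} (u : κ → V) (π : κ → κ) (a : κ → ℤ)
    (hu : Submodule.span K (Set.range fun x : κ × ℤ => (φ ^ x.2) (u x.1)) = ⊤)
    (hπ : ∀ k, π (π k) = k) (ha : ∀ k, a (π k) = a k) (hq : ∀ k, Q (u (π k)) = Q (u k))
    (hf : ∀ k l i, polar Q ((φ ^ i) (u k)) (u l) =
      polar Q ((φ ^ (a k - a l - i)) (u (π k))) (u (π l))) :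
    ∃ σ ∈ orthogonalGroup Q, IsInvolution σ ∧ Inverts σ φ ∧
      ∀ k (i : ℤ), σ ((φ ^ i) (u k)) = (φ ^ (a k - i)) (u (π k)) := by
  have hQφ : ∀ (i : ℤ) x, Q ((φ ^ i) x) = Q x := fun i => zpow_mem hφ i
  have hu' : Submodule.span K
      (Set.range fun x : κ × ℤ => (φ ^ (a x.1 - x.2)) (u (π x.1))) = ⊤ := by
    rw [eq_top_iff, ← hu]
    refine Submodule.span_mono ?_
    rintro _ ⟨x, rfl⟩
    exact ⟨(π x.1, a x.1 - x.2), by simp [hπ, ha]⟩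
  obtain ⟨σ, hσ, h⟩ := exists_isometry hQ hu hu' (fun x => by simp only [hQφ, hq])
    (fun x y => by simp only [polar_zpow hφ]; rw [hf]; congr 3; ring)
  have h' : ∀ k (i : ℤ), σ ((φ ^ i) (u k)) = (φ ^ (a k - i)) (u (π k)) := fun k i => h (k, i)
  refine ⟨σ, hσ, linearEquiv_ext_span hu fun x => ?_,
    inverts_iff.2 (linearEquiv_ext_span hu fun x => ?_), h'⟩
  · rw [LinearEquiv.mul_apply, h', h', hπ, ha, sub_sub_cancel]; rfl
  · rw [LinearEquiv.mul_apply, LinearEquiv.mul_apply, h', ← zpow_neg_one φ,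
      zpow_apply_zpow_apply, h']
    nth_rw 1 [← zpow_one φ]
    rw [zpow_apply_zpow_apply]
    congr 2
    ring

/-- Upper bound for the fix space of an involution that reverses `φ`-orbits. -/
theorem card_mul_add_finrank_fix_le [FiniteDimensional K V] {φ σ : V ≃ₗ[K] V} {κ : Type*}
    [Fintype κ] {u : κ → V} {m h : ℕ} {a : κ → ℤ}
    (hu : LinearIndependent K fun x : κ × Fin m => (φ ^ (x.2 : ℕ)) (u x.1))
    (hσ : ∀ k (i : ℤ), σ ((φ ^ i) (u k)) = (φ ^ (a k - i)) (u k))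
    (ha : ∀ k, 2 * h ≤ a k + 1 ∧ a k < m) (hm : h ≤ m) :
    Fintype.card κ * h + finrank K (fix σ) ≤ finrank K V := by
  let S : Finset (κ × Fin m) := Finset.univ ×ˢ Finset.univ.filter fun i : Fin m => (i : ℕ) < h
  have hS : S.card = Fintype.card κ * h := by
    rw [Finset.card_product, Finset.card_univ, Fin.card_filter_val_lt, min_eq_right hm]
  rw [← hS]
  refine card_add_finrank_fix_le hu S fun x hx => ?_
  have hx' : (x.2 : ℕ) < h := by simpa [S] using hx
  -- For i < h the reflected exponent a - i is at least h because 2h ≤ a + 1, and below m because a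
  -- < m.
  obtain ⟨j, hj⟩ : ∃ j : ℕ, (j : ℤ) = a x.1 - (x.2 : ℕ) :=
    ⟨(a x.1 - (x.2 : ℕ)).toNat, Int.toNat_of_nonneg (by have := ha x.1; omega)⟩
  refine ⟨(x.1, ⟨j, by have := ha x.1; omega⟩), ?_, ?_⟩
  · simp only [S, Finset.mem_product, Finset.mem_univ, Finset.mem_filter, true_and]
    have := ha x.1
    omega
  · have := hσ x.1 (x.2 : ℕ)
    rw [← hj, zpow_natCast, zpow_natCast] at this
    exact this

theorem zpow_apply_sub_mem_range (φ : V ≃ₗ[K] V) (i : ℤ) (x : V) :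
    (φ ^ i) x - x ∈ LinearMap.range ((φ : End K V) - 1) := by
  have h1 : ∀ y, φ y - y ∈ LinearMap.range ((φ : End K V) - 1) := fun y => ⟨y, rfl⟩
  induction i using Int.induction_on with
  | zero => simp
  | succ i ih =>
    have := add_mem ih (h1 ((φ ^ (i : ℤ)) x))
    rw [add_comm (i : ℤ), zpow_add, zpow_one, LinearEquiv.mul_apply]
    simpa using this
  | pred i ih =>
    have h2 := h1 ((φ ^ (-(i : ℤ) - 1)) x)
    have h3 : φ ((φ ^ (-(i : ℤ) - 1)) x) = (φ ^ (-(i : ℤ))) x := by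
      rw [← LinearEquiv.mul_apply, ← zpow_one_add, add_sub_cancel]
    rw [h3] at h2
    simpa using sub_mem ih h2

/-- Reversal moves each orbit vector within its own orbit, and vectors of one orbit agree modulo
range(φ - 1). -/
theorem range_sub_one_le [CharP K 2] {φ σ : V ≃ₗ[K] V} {κ : Type*} {u : κ → V} {a : κ → ℤ}
    (hu : Submodule.span K (Set.range fun x : κ × ℤ => (φ ^ x.2) (u x.1)) = ⊤)
    (hσ : ∀ k (i : ℤ), σ ((φ ^ i) (u k)) = (φ ^ (a k - i)) (u k)) :
    LinearMap.range ((σ : End K V) - 1) ≤ LinearMap.range ((φ : End K V) - 1) := by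
  rw [LinearMap.range_eq_map, ← hu, Submodule.map_span_le]
  rintro _ ⟨x, rfl⟩
  have h := zpow_apply_sub_mem_range φ (a x.1 - x.2 - x.2) ((φ ^ x.2) (u x.1))
  rw [zpow_apply_zpow_apply, sub_add_cancel, ← hσ] at h
  exact h

/-! ### Cyclic isometries -/

theorem aeval_X_pow_apply (φ : V ≃ₗ[K] V) (k : ℕ) (v : V) :
    aeval (φ : End K V) (X ^ k : K[X]) v = (φ ^ k) v := by
  rw [map_pow, aeval_X]
  induction k with
  | zero => rfl
  | succ k ih => rw [pow_succ', pow_succ', Module.End.mul_apply, ih]; rfl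

theorem aeval_apply_mem_span (φ : V ≃ₗ[K] V) (v : V) (p : K[X]) :
    aeval (φ : End K V) p v ∈
      Submodule.span K ((fun k : ℕ => (φ ^ k) v) '' {k | (k : WithBot ℕ) ≤ p.degree}) := by
  have hp : aeval (φ : End K V) p v = aeval (φ : End K V)
      (∑ k ∈ p.support, monomial k (p.coeff k)) v := by rw [← p.as_sum_support]
  rw [hp, map_sum, LinearMap.sum_apply]
  refine sum_mem fun k hk => ?_
  rw [← C_mul_X_pow_eq_monomial, map_mul, aeval_C, Module.End.mul_apply, aeval_X_pow_apply]
  exact Submodule.smul_mem _ _ (Submodule.subset_span ⟨k, le_degree_of_mem_supp k hk, rfl⟩)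

/-- An annihilating polynomial bounds the number of powers needed to span. -/
theorem span_fin_eq_top {φ : V ≃ₗ[K] V} {κ : Type*} {u : κ → V}
    (hu : Submodule.span K (Set.range fun x : κ × ℕ => (φ ^ x.2) (u x.1)) = ⊤)
    {M : K[X]} (hM : M.Monic) (hφM : aeval (φ : End K V) M = 0) {d : ℕ} (hd : M.natDegree = d) :
    Submodule.span K (Set.range fun x : κ × Fin d => (φ ^ (x.2 : ℕ)) (u x.1)) = ⊤ := by
  rw [eq_top_iff, ← hu, Submodule.span_le]
  rintro _ ⟨x, rfl⟩
  have h : (φ ^ x.2) (u x.1) = aeval (φ : End K V) (X ^ x.2 %ₘ M) (u x.1) := by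
    conv_lhs => rw [← aeval_X_pow_apply, ← modByMonic_add_div (X ^ x.2) M]
    simp [hφM]
  simp only [h]
  refine Submodule.span_mono ?_ (aeval_apply_mem_span φ (u x.1) _)
  rintro _ ⟨k, hk, rfl⟩
  refine ⟨(x.1, ⟨k, ?_⟩), rfl⟩
  have := lt_of_le_of_lt hk (degree_modByMonic_lt _ hM)
  rw [degree_eq_natDegree hM.ne_zero, hd] at this
  exact_mod_cast this

theorem IsCyclic.exists_linearIndependent [FiniteDimensional K V] {φ : V ≃ₗ[K] V}
    (h : IsCyclic φ) : ∃ v : V,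
      Submodule.span K (Set.range fun x : Unit × ℤ => (φ ^ x.2) v) = ⊤ ∧
      LinearIndependent K fun x : Unit × Fin (finrank K V) => (φ ^ (x.2 : ℕ)) v := by
  obtain ⟨v, hv⟩ := h
  have hv' : Submodule.span K (Set.range fun x : Unit × ℕ => (φ ^ x.2) v) = ⊤ := by
    rw [eq_top_iff, ← hv]
    refine Submodule.span_mono ?_
    rintro _ ⟨k, rfl⟩
    exact ⟨((), k), rfl⟩
  refine ⟨v, ?_, linearIndependent_of_top_le_span_of_card_eq_finrank
    (span_fin_eq_top (u := fun _ : Unit => v) hv'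
      (LinearMap.charpoly_monic (φ : End K V)) (LinearMap.aeval_self_charpoly _)
      (LinearMap.charpoly_natDegree _)).ge (by simp)⟩
  rw [eq_top_iff, ← hv]
  refine Submodule.span_mono ?_
  rintro _ ⟨k, rfl⟩
  exact ⟨((), k), by simp⟩

theorem IsCyclic.natDegree_minpoly [FiniteDimensional K V] {φ : V ≃ₗ[K] V}
    (h : IsCyclic φ) : (minpoly K (φ : End K V)).natDegree = finrank K V := by
  obtain ⟨v, hv⟩ := h
  have hv' : Submodule.span K (Set.range fun x : Unit × ℕ => (φ ^ x.2) v) = ⊤ := by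
    rw [eq_top_iff, ← hv]
    refine Submodule.span_mono ?_
    rintro _ ⟨k, rfl⟩
    exact ⟨((), k), rfl⟩
  apply le_antisymm
  · rw [← LinearMap.charpoly_natDegree (φ : End K V)]
    exact natDegree_le_of_dvd (LinearMap.minpoly_dvd_charpoly _)
      (LinearMap.charpoly_monic _).ne_zero
  · have := finrank_range_le_card (R := K)
      (fun x : Unit × Fin (minpoly K (φ : End K V)).natDegree => (φ ^ (x.2 : ℕ)) v)
    rw [Set.finrank, span_fin_eq_top (u := fun _ : Unit => v) hv'
      (minpoly.monic (Algebra.IsIntegral.isIntegral _))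
      (minpoly.aeval _ _) rfl, finrank_top] at this
    simpa using this

theorem exists_involution_of_span {Q : QuadraticForm K V}
    (hQ : IsNondefective Q) {φ : V ≃ₗ[K] V} (hφ : φ ∈ orthogonalGroup Q) {v : V}
    (hv : Submodule.span K (Set.range fun x : Unit × ℤ => (φ ^ x.2) v) = ⊤) (a : ℤ) :
    ∃ σ ∈ orthogonalGroup Q, IsInvolution σ ∧ Inverts σ φ ∧
      ∀ i : ℤ, σ ((φ ^ i) v) = (φ ^ (a - i)) v := by
  obtain ⟨σ, hσ, h1, h2, h3⟩ := exists_reversing_involution hQ hφ (fun _ : Unit => v) id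
    (fun _ => a) hv (fun _ => rfl) (fun _ => rfl) (fun _ => rfl) (fun _ _ i => by
      have := polar_zpow hφ 0 i v v
      rw [polar_comm, zpow_zero, LinearEquiv.coe_one, id, zero_sub] at this
      rw [this, sub_self, zero_sub])
  exact ⟨σ, hσ, h1, h2, fun i => h3 () i⟩

theorem IsCyclic.exists_involution_half [CharP K 2] [FiniteDimensional K V]
    {Q : QuadraticForm K V} (hQ : IsNondefective Q) {φ : V ≃ₗ[K] V} (hφ : φ ∈ orthogonalGroup Q)
    (hc : IsCyclic φ) : ∃ σ ∈ orthogonalGroup Q, IsInvolution σ ∧ Inverts σ φ ∧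
      2 * finrank K (fix σ) = finrank K V := by
  obtain ⟨v, hv, hi⟩ := hc.exists_linearIndependent
  obtain ⟨n, hn⟩ := hQ.even_finrank
  -- With dim V = 2n, the reflection i ↦ 2n - 1 - i exchanges the first n exponents with the last n.
  obtain ⟨σ, hσ, h1, h2, h3⟩ := exists_involution_of_span hQ hφ hv (2 * n - 1)
  refine ⟨σ, hσ, h1, h2, ?_⟩
  have h4 := card_mul_add_finrank_fix_le (h := n) (a := fun _ => 2 * n - 1)
    (u := fun _ : Unit => v) hi (fun _ => h3) (fun _ => by omega) (by omega)
  have h5 := h1.finrank_le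
  simp only [Fintype.card_unit] at h4
  omega

theorem IsUnipotent.range_ne_top [Nontrivial V] {φ : V ≃ₗ[K] V} (h : IsUnipotent φ) :
    LinearMap.range ((φ : End K V) - 1) ≠ ⊤ := by
  intro ht
  obtain ⟨k, hk⟩ := h
  have hs : Function.Surjective (((φ : End K V) - 1) ^ k : End K V) := by
    rw [Module.End.coe_pow ((φ : End K V) - 1)]
    exact (LinearMap.range_eq_top.1 ht).iterate k
  obtain ⟨x, hx⟩ := exists_ne (0 : V)
  obtain ⟨y, rfl⟩ := hs x
  rw [hk] at hx
  exact hx rfl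

theorem IsCyclic.exists_involution_half_add_one [CharP K 2] [FiniteDimensional K V] [Nontrivial V]
    {Q : QuadraticForm K V} (hQ : IsNondefective Q) {φ : V ≃ₗ[K] V} (hφ : φ ∈ orthogonalGroup Q)
    (hc : IsCyclic φ) (hu : IsUnipotent φ) : ∃ σ ∈ orthogonalGroup Q, IsInvolution σ ∧
      Inverts σ φ ∧ 2 * finrank K (fix σ) = finrank K V + 2 := by
  obtain ⟨v, hv, hi⟩ := hc.exists_linearIndependent
  obtain ⟨n, hn⟩ := hQ.even_finrank
  have hpos : 0 < finrank K V := finrank_pos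
  -- An even sum of exponents leaves n - 1 fixed. Only n - 1 basis vectors are counted as moved, so
  -- the fix space has dimension at most n + 1.
  obtain ⟨σ, hσ, h1, h2, h3⟩ := exists_involution_of_span hQ hφ hv (2 * (n - 1))
  refine ⟨σ, hσ, h1, h2, ?_⟩
  have h4 := card_mul_add_finrank_fix_le (h := n - 1) (a := fun _ => 2 * (n - 1))
    (u := fun _ : Unit => v) hi (fun _ => h3) (fun _ => by omega) (by omega)
  have hr := range_sub_one_le (u := fun _ : Unit => v) hv (fun _ => h3)
  -- If this fixed vector lay in range(σ - 1), the whole orbit would lie in range(φ - 1), which is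
  -- proper for unipotent φ.
  have h5 := h1.finrank_lt (u := (φ ^ ((n : ℤ) - 1)) v) (by rw [h3]; congr 2; ring) fun hmem => by
    refine hu.range_ne_top (eq_top_iff.2 ?_)
    rw [← hv, Submodule.span_le]
    rintro _ ⟨x, rfl⟩
    have := add_mem (zpow_apply_sub_mem_range φ (x.2 - ((n : ℤ) - 1)) ((φ ^ ((n : ℤ) - 1)) v))
      (hr hmem)
    rwa [zpow_apply_zpow_apply, sub_add_cancel, sub_add_cancel] at this
  simp only [Fintype.card_unit] at h4
  omega

/-- An involution inverting a cyclic isometry `φ` fixes `Fix(φ)` pointwise. -/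
theorem IsCyclic.fix_eq_inf [CharP K 2] {Q : QuadraticForm K V} (hQ : IsNondefective Q)
    {φ : V ≃ₗ[K] V} (hφ : φ ∈ orthogonalGroup Q) (hc : IsCyclic φ) {σ : V ≃ₗ[K] V}
    (hσ : IsInvolution σ) (hσφ : Inverts σ φ) : fix φ = fix σ ⊓ fix (σ * φ) := by
  obtain ⟨v, hv⟩ := hc
  -- A fixed vector pairs equally with all φ^k v, so it is determined by its pairing with the
  -- generator: Fix(φ) is at most one-dimensional.
  have key : ∀ x ∈ fix φ, polar Q x v = 0 → x = 0 := by
    intro x hx hxv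
    rw [mem_fix] at hx
    refine hQ.eq_zero_of_polar fun y => ?_
    have hy : y ∈ Submodule.span K (Set.range fun k : ℕ => (φ ^ k) v) := hv ▸ Submodule.mem_top
    induction hy using Submodule.span_induction with
    | mem y hy =>
      obtain ⟨k, rfl⟩ := hy
      induction k with
      | zero => exact hxv
      | succ k ih =>
        simp only at ih ⊢
        rw [pow_succ', LinearEquiv.mul_apply]
        nth_rw 1 [← hx]
        rw [polar_map hφ, ih]
    | zero => rw [polar_zero_right]
    | add y z _ _ hy hz => rw [polar_add_right, hy, hz, add_zero]
    | smul c y _ hy => rw [polar_smul_right, hy, smul_zero]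
  have hfix : ∀ x ∈ fix φ, σ x ∈ fix φ := by
    intro x hx
    rw [mem_fix] at hx ⊢
    have h := congr($(inverts_iff.1 hσφ) x)
    rw [LinearEquiv.mul_apply, LinearEquiv.mul_apply] at h
    rw [h]
    nth_rw 1 [← hx]
    exact congr(σ $(φ.symm_apply_apply x))
  have hle : fix φ ≤ fix σ := by
    intro x hx
    rw [mem_fix]
    by_cases hxv : polar Q x v = 0
    · rw [key x hx hxv, map_zero]
    obtain ⟨c, hc⟩ : ∃ c : K, σ x = c • x := by
      refine ⟨polar Q (σ x) v / polar Q x v, ?_⟩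
      rw [← sub_eq_zero]
      refine key _ (sub_mem (hfix x hx) (Submodule.smul_mem _ _ hx)) ?_
      rw [polar_sub_left, polar_smul_left, smul_eq_mul, div_mul_cancel₀ _ hxv, sub_self]
    have h2 : (c * c) • x = x := by
      rw [mul_smul, ← hc, ← map_smul, ← hc, hσ.apply_apply]
    have h3 : (c * c - 1) • x = 0 := by rw [sub_smul, h2, one_smul, sub_self]
    rcases smul_eq_zero.1 h3 with h | h
    · have : (c + 1) * (c + 1) = 0 := by
        rw [CharTwo.add_mul_self]
        linear_combination h + CharTwo.two_eq_zero (R := K)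
      have hc1 : c = 1 := by
        rw [← CharTwo.neg_eq (1 : K)]
        exact eq_neg_of_add_eq_zero_left (mul_self_eq_zero.1 this)
      rw [hc, hc1, one_smul]
    · rw [h, map_zero]
  ext x
  rw [Submodule.mem_inf]
  constructor
  · intro hx
    refine ⟨hle hx, ?_⟩
    rw [mem_fix, LinearEquiv.mul_apply, mem_fix.1 hx, mem_fix.1 (hle hx)]
  · rintro ⟨h1, h2⟩
    rw [mem_fix] at h1 h2 ⊢
    apply σ.injective
    rw [h1, ← LinearEquiv.mul_apply, h2]

/-! ### Unipotent isometries -/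

/-- The adjoint of φ is φ⁻¹, so in characteristic 2 the adjoint of N is φ⁻¹N: powers of N are
self-adjoint up to a power of φ. -/
theorem polar_sub_one_pow [CharP K 2] {Q : QuadraticForm K V} {φ : V ≃ₗ[K] V}
    (hφ : φ ∈ orthogonalGroup Q) (j : ℕ) (x y : V) :
    polar Q ((((φ : End K V) - 1) ^ j) x) ((φ ^ j) y) =
      polar Q x ((((φ : End K V) - 1) ^ j) y) := by
  induction j generalizing y with
  | zero => rfl
  | succ j ih =>
    have h1 : ∀ a b, polar Q (((φ : End K V) - 1) a) (φ b) = polar Q a (((φ : End K V) - 1) b) := by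
      intro a b
      simp only [LinearMap.sub_apply, LinearEquiv.coe_coe, End.one_apply, polar_sub_left,
        polar_sub_right, polar_map hφ]
      rw [← CharTwo.neg_eq (polar Q a b - polar Q a (φ b)), neg_sub]
    have h2 : ((φ : End K V) - 1) ((φ ^ j) y) = (φ ^ j) (((φ : End K V) - 1) y) := by
      simp only [LinearMap.sub_apply, LinearEquiv.coe_coe, End.one_apply, map_sub]
      rw [← LinearEquiv.mul_apply, ← LinearEquiv.mul_apply, ← pow_succ, ← pow_succ']
    rw [pow_succ', pow_succ', Module.End.mul_apply, LinearEquiv.mul_apply, h1, h2, ih, ← pow_succ',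
      pow_succ, Module.End.mul_apply]

theorem sub_one_apply_eq_zero {φ : V ≃ₗ[K] V} {x : V} :
    ((φ : End K V) - 1) x = 0 ↔ φ x = x := by
  rw [LinearMap.sub_apply, sub_eq_zero]; rfl

theorem pow_apply_eq_self {φ : V ≃ₗ[K] V} {x : V} (h : φ x = x) (j : ℕ) : (φ ^ j) x = x := by
  induction j with
  | zero => rfl
  | succ j ih => rw [pow_succ', LinearEquiv.mul_apply, ih, h]

theorem polar_pow_right_of_apply_eq {Q : QuadraticForm K V} {φ : V ≃ₗ[K] V}
    (hφ : φ ∈ orthogonalGroup Q) {x : V} (h : φ x = x) (j : ℕ) (y : V) :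
    polar Q x ((φ ^ j) y) = polar Q x y := by
  nth_rw 1 [← pow_apply_eq_self h j]
  exact polar_map (pow_mem hφ j) x y

theorem polar_zpow_comm {Q : QuadraticForm K V} {φ : V ≃ₗ[K] V}
    (hφ : φ ∈ orthogonalGroup Q) (i : ℤ) (x y : V) :
    polar Q ((φ ^ i) x) y = polar Q ((φ ^ (-i)) y) x := by
  have := polar_zpow hφ 0 i y x
  rwa [zpow_zero, LinearEquiv.coe_one, id, zero_sub, polar_comm] at this

theorem polar_eq_zero_of_mem_span {Q : QuadraticForm K V} {S : Set V} {x y : V}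
    (h : ∀ z ∈ S, polar Q x z = 0) (hy : y ∈ Submodule.span K S) : polar Q x y = 0 := by
  induction hy using Submodule.span_induction with
  | mem z hz => exact h z hz
  | zero => rw [polar_zero_right]
  | add y z _ _ hy hz => rw [polar_add_right, hy, hz, add_zero]
  | smul c y _ hy => rw [polar_smul_right, hy, smul_zero]

theorem polar_aeval_eq_zero {Q : QuadraticForm K V} {φ : V ≃ₗ[K] V} {x v : V}
    (h : ∀ j : ℕ, polar Q x ((φ ^ j) v) = 0) (p : K[X]) :
    polar Q x (aeval (φ : End K V) p v) = 0 :=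
  polar_eq_zero_of_mem_span (by rintro _ ⟨j, -, rfl⟩; exact h j) (aeval_apply_mem_span φ v p)

theorem aeval_sub_one_pow (φ : V ≃ₗ[K] V) (j : ℕ) :
    aeval (φ : End K V) ((X - 1) ^ j : K[X]) = ((φ : End K V) - 1) ^ j := by
  simp

theorem monic_sub_one_pow (j : ℕ) : ((X - 1) ^ j : K[X]).Monic := by
  rw [← C_1]; exact (monic_X_sub_C 1).pow j

theorem natDegree_sub_one_pow (j : ℕ) : ((X - 1) ^ j : K[X]).natDegree = j := by
  rw [← C_1, natDegree_pow, natDegree_X_sub_C, mul_one]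

section Gram

variable [CharP K 2] {Q : QuadraticForm K V} {φ : V ≃ₗ[K] V} {κ : Type*} [Fintype κ] {u : κ → V}
  {k : ℕ}

/-- If the pairing `(x, y) ↦ f((φ - 1)^k x, y)` is nondegenerate on the vectors `u i`, then
the orbits of the `u i` are as free and as nondegenerate as possible. -/
theorem sub_one_pow_dvd_of_orthogonal (hφ : φ ∈ orthogonalGroup Q)
    (hN : ((φ : End K V) - 1) ^ (k + 1) = 0)
    (hG : ∀ c : κ → K, (∀ l, ∑ i, c i * polar Q ((((φ : End K V) - 1) ^ k) (u i)) (u l) = 0) →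
      ∀ i, c i = 0) (p : κ → K[X])
    (hp : ∀ l (j : ℕ), polar Q (∑ i, aeval (φ : End K V) (p i) (u i)) ((φ ^ j) (u l)) = 0) :
    ∀ i, (X - 1) ^ (k + 1) ∣ p i := by
  set N := (φ : End K V) - 1 with hNdef
  set x := ∑ i, aeval (φ : End K V) (p i) (u i) with hx
  suffices h : ∀ j ≤ k + 1, ∀ i, (X - 1) ^ j ∣ p i from h _ le_rfl
  intro j
  induction j with
  | zero => simp
  | succ j ih =>
    intro hj
    choose q hq using ih (by omega)
    -- Since N^(k+1) = 0, φ acts as 1 on the image of N^k, so q(φ) acts there as q(1).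
    have hNq : ∀ i, (N ^ k) (aeval (φ : End K V) (q i) (u i)) =
        (q i).eval 1 • (N ^ k) (u i) := by
      intro i
      obtain ⟨r, hr⟩ := X_sub_C_dvd_sub_C_eval (a := (1 : K)) (p := q i)
      have h1 : N ^ k * aeval (φ : End K V) (q i) = (q i).eval 1 • N ^ k := by
        rw [sub_eq_iff_eq_add.1 hr, map_add, map_mul, aeval_C, mul_add, ← mul_assoc, C_1, map_sub,
          aeval_X, map_one, ← hNdef, ← pow_succ, hN, zero_mul, zero_add,
          Algebra.algebraMap_eq_smul_one,
          mul_smul_comm, mul_one, eval_add, eval_mul, eval_C, eval_sub, eval_X, eval_one, sub_self,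
          zero_mul, zero_add]
      exact congr($h1 (u i))
    have hNx : (N ^ (k - j)) x = ∑ i, (q i).eval 1 • (N ^ k) (u i) := by
      rw [hx, map_sum]
      refine Finset.sum_congr rfl fun i _ => ?_
      rw [hq, map_mul, aeval_sub_one_pow, ← Module.End.mul_apply, ← mul_assoc, ← hNdef, ← pow_add,
        Nat.sub_add_cancel (by omega), Module.End.mul_apply, hNq]
    have hfixed : φ ((N ^ (k - j)) x) = (N ^ (k - j)) x := by
      rw [← sub_one_apply_eq_zero, ← hNdef, hNx, map_sum]
      refine Finset.sum_eq_zero fun i _ => ?_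
      rw [map_smul, ← Module.End.mul_apply, ← pow_succ', hN, LinearMap.zero_apply, smul_zero]
    -- N^(k-j) x is fixed by φ, so a factor φ^(k-j) may be inserted on the right and N^(k-j) moved
    -- across, where `hp` applies. Thus every q_i(1) vanishes, giving one more factor X - 1.
    have hev := hG (fun i => (q i).eval 1) fun l => by
      have : polar Q ((N ^ (k - j)) x) (u l) = 0 := by
        rw [← polar_pow_right_of_apply_eq hφ hfixed (k - j), polar_sub_one_pow hφ,
          ← aeval_sub_one_pow]
        exact polar_aeval_eq_zero (hp l) _
      rw [hNx, ← polarBilin_apply_apply, map_sum, LinearMap.sum_apply] at this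
      simpa using this
    intro i
    obtain ⟨r, hr⟩ := dvd_iff_isRoot.2 (hev i)
    exact ⟨r, by rw [hq, hr, C_1, pow_succ, mul_assoc]⟩

/-- A linear relation is a family of polynomials of degree at most k whose combination is 0. They
are divisible by (X - 1)^(k+1), hence zero. -/
theorem linearIndependent_of_gram (hφ : φ ∈ orthogonalGroup Q)
    (hN : ((φ : End K V) - 1) ^ (k + 1) = 0)
    (hG : ∀ c : κ → K, (∀ l, ∑ i, c i * polar Q ((((φ : End K V) - 1) ^ k) (u i)) (u l) = 0) →
      ∀ i, c i = 0) :
    LinearIndependent K fun x : κ × Fin (k + 1) => (φ ^ (x.2 : ℕ)) (u x.1) := by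
  rw [Fintype.linearIndependent_iff]
  intro g hg x
  have hsum : ∑ i, aeval (φ : End K V)
      (∑ j : Fin (k + 1), C (g (i, j)) * X ^ (j : ℕ)) (u i) = 0 := by
    rw [← hg, Fintype.sum_prod_type]
    refine Finset.sum_congr rfl fun i _ => ?_
    rw [map_sum, LinearMap.sum_apply]
    refine Finset.sum_congr rfl fun j _ => ?_
    rw [map_mul, aeval_C, Module.End.mul_apply, aeval_X_pow_apply, Module.algebraMap_end_apply]
  have hdvd := sub_one_pow_dvd_of_orthogonal hφ hN hG
    (fun i => ∑ j : Fin (k + 1), C (g (i, j)) * X ^ (j : ℕ))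
    (fun l j => by rw [hsum, polar_zero_left]) x.1
  have h0 := eq_zero_of_dvd_of_degree_lt hdvd (by
    rw [degree_eq_natDegree (monic_sub_one_pow _).ne_zero, natDegree_sub_one_pow]
    exact degree_sum_fin_lt fun j => g (x.1, j))
  have := congr(coeff $h0 x.2)
  simpa [finsetSum_coeff, coeff_C_mul_X_pow, Fin.val_inj] using this

/-- The span of the orbits is invariant, and by the divisibility lemma any vector in its radical is
killed by N^(k+1) = 0. So it is nondefective and nonzero, hence everything. -/
theorem span_eq_top_of_gram (hφ : φ ∈ orthogonalGroup Q) (hind : IsOrthIndecomposable Q φ)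
    (hN : ((φ : End K V) - 1) ^ (k + 1) = 0)
    (hG : ∀ c : κ → K, (∀ l, ∑ i, c i * polar Q ((((φ : End K V) - 1) ^ k) (u i)) (u l) = 0) →
      ∀ i, c i = 0) (hu : ∃ l, u l ≠ 0) :
    Submodule.span K (Set.range fun x : κ × ℕ => (φ ^ x.2) (u x.1)) = ⊤ := by
  classical
  refine (hind _ ?_ (isNondefective_restrict fun x hx h => ?_)).resolve_left ?_
  · intro x hx
    induction hx using Submodule.span_induction with
    | mem x hx =>
      obtain ⟨y, rfl⟩ := hx
      exact Submodule.subset_span ⟨(y.1, y.2 + 1), by simp only [pow_succ']; rfl⟩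
    | zero => simp
    | add x y _ _ hx hy => rw [map_add]; exact add_mem hx hy
    | smul c x _ hx => rw [map_smul]; exact Submodule.smul_mem _ _ hx
  · obtain ⟨p, rfl⟩ : ∃ p : κ → K[X], x = ∑ i, aeval (φ : End K V) (p i) (u i) := by
      clear h
      induction hx using Submodule.span_induction with
      | mem x hx =>
        obtain ⟨y, rfl⟩ := hx
        refine ⟨Pi.single y.1 (X ^ y.2), ?_⟩
        rw [Finset.sum_eq_single y.1 (fun i _ hi => by simp [Pi.single_eq_of_ne hi]) (by simp),
          Pi.single_eq_same, aeval_X_pow_apply]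
      | zero => exact ⟨0, by simp⟩
      | add x y _ _ hx hy =>
        obtain ⟨p, rfl⟩ := hx
        obtain ⟨q, rfl⟩ := hy
        exact ⟨p + q, by simp [Finset.sum_add_distrib]⟩
      | smul c x _ hx =>
        obtain ⟨p, rfl⟩ := hx
        exact ⟨c • p, by simp [Finset.smul_sum]⟩
    have hdvd := sub_one_pow_dvd_of_orthogonal hφ hN hG p fun l j =>
      h _ (Submodule.subset_span ⟨(l, j), rfl⟩)
    refine Finset.sum_eq_zero fun i _ => ?_
    obtain ⟨r, hr⟩ := hdvd i
    rw [hr, map_mul, aeval_sub_one_pow, hN, zero_mul, LinearMap.zero_apply]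
  · obtain ⟨l, hl⟩ := hu
    exact fun h => hl ((Submodule.mem_bot K).1 (h ▸ Submodule.subset_span ⟨(l, 0), rfl⟩))

end Gram

/-! ### Sequences annihilated by a power of the shift plus one -/

/-- In characteristic two: `(S + 1)^m D = 0` where `S` is the shift. -/
def BinomialRecurrent (m : ℕ) (D : ℤ → K) : Prop :=
  ∀ j : ℤ, ∑ i ∈ Finset.range (m + 1), (m.choose i : K) * D (j + i) = 0

theorem BinomialRecurrent.add {m : ℕ} {D E : ℤ → K} (hD : BinomialRecurrent m D)
    (hE : BinomialRecurrent m E) : BinomialRecurrent m fun j => D j + E j := fun j => by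
  simp only [mul_add, Finset.sum_add_distrib, hD j, hE j, add_zero]

theorem BinomialRecurrent.reflect {m : ℕ} {D : ℤ → K} (hD : BinomialRecurrent m D) (c : ℤ) :
    BinomialRecurrent m fun j => D (c - j) := fun j => by
  rw [← hD (c - j - m), ← Finset.sum_flip]
  refine Finset.sum_congr rfl fun i hi => ?_
  have hi : i ≤ m := Nat.lt_succ_iff.1 (Finset.mem_range.1 hi)
  rw [Nat.choose_symm hi, Nat.cast_sub hi, show c - j - m + i = c - (j + (m - i)) by ring]

/-- The two outer coefficients are 1, so m consecutive zeros propagate in both directions.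
Symmetries of Gram sequences thus need checking only on a window of length m. -/
theorem BinomialRecurrent.eq_zero {m : ℕ} {D : ℤ → K} (hD : BinomialRecurrent m D) {s : ℤ}
    (h : ∀ i : ℕ, i < m → D (s + i) = 0) (j : ℤ) : D j = 0 := by
  have up : ∀ t : ℤ, (∀ i : ℕ, i < m → D (t + i) = 0) → D (t + m) = 0 := by
    intro t ht
    have := hD t
    rw [Finset.sum_range_succ, Finset.sum_eq_zero fun i hi => by
      rw [ht i (Finset.mem_range.1 hi), mul_zero]] at this
    simpa using this
  have down : ∀ t : ℤ, (∀ i : ℕ, i < m → D (t + i) = 0) → D (t - 1) = 0 := by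
    intro t ht
    have := hD (t - 1)
    rw [Finset.sum_range_succ', Finset.sum_eq_zero fun i hi => by
      rw [Nat.cast_succ, sub_add_add_cancel, ht i (Finset.mem_range.1 hi), mul_zero]] at this
    simpa using this
  have key : ∀ t : ℤ, ∀ i : ℕ, i < m → D (s + t + i) = 0 := by
    intro t
    induction t using Int.induction_on with
    | zero => simpa using h
    | succ t ih =>
      intro i hi
      rcases Nat.lt_or_ge (i + 1) m with h' | h'
      · have := ih (i + 1) h'
        push_cast at this
        rw [← this]; congr 1; ring
      · have := up _ ih
        rw [← this]; congr 1; omega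
    | pred t ih =>
      intro i hi
      rcases Nat.eq_zero_or_pos i with h' | h'
      · have := down _ ih
        rw [← this]; congr 1; omega
      · have := ih (i - 1) (by omega)
        rw [← this]; congr 1; omega
  rcases Nat.eq_zero_or_pos m with rfl | hm
  · simpa using hD j
  · simpa using key (j - s) 0 hm

theorem sub_one_pow_apply_eq_sum [CharP K 2] (φ : V ≃ₗ[K] V) (m : ℕ) (x : V) :
    (((φ : End K V) - 1) ^ m) x =
      ∑ i ∈ Finset.range (m + 1), (m.choose i : K) • (φ ^ i) x := by
  have h : ((X - 1) ^ m : K[X]) = ∑ i ∈ Finset.range (m + 1), C (m.choose i : K) * X ^ i := by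
    rw [CharTwo.sub_eq_add, add_pow]
    refine Finset.sum_congr rfl fun i _ => ?_
    rw [one_pow, mul_one, mul_comm]
    simp
  rw [← aeval_sub_one_pow, h, map_sum, LinearMap.sum_apply]
  refine Finset.sum_congr rfl fun i _ => ?_
  rw [map_mul, aeval_C, Module.End.mul_apply, aeval_X_pow_apply, Module.algebraMap_end_apply]

theorem polar_sub_one_pow_apply [CharP K 2] (Q : QuadraticForm K V) (φ : V ≃ₗ[K] V) (m : ℕ)
    (x y : V) : polar Q ((((φ : End K V) - 1) ^ m) x) y =
      ∑ i ∈ Finset.range (m + 1), (m.choose i : K) * polar Q ((φ ^ i) x) y := by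
  rw [sub_one_pow_apply_eq_sum, ← polarBilin_apply_apply, map_sum, LinearMap.sum_apply]
  simp

theorem binomialRecurrent_polar [CharP K 2] (Q : QuadraticForm K V) {φ : V ≃ₗ[K] V} {m : ℕ}
    (hN : ((φ : End K V) - 1) ^ m = 0) (x y : V) :
    BinomialRecurrent m fun j => polar Q ((φ ^ j) x) y := fun j => by
  have := polar_sub_one_pow_apply Q φ m ((φ ^ j) x) y
  rw [hN, LinearMap.zero_apply, polar_zero_left] at this
  rw [this]
  refine Finset.sum_congr rfl fun i _ => ?_
  rw [← zpow_natCast, zpow_apply_zpow_apply, add_comm]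

/-! ### Unipotent isometries with two equal Jordan blocks -/

theorem polar_sub_one_pow_swap [CharP K 2] {Q : QuadraticForm K V} {φ : V ≃ₗ[K] V} {k : ℕ}
    (hB : ∀ x, polar Q ((((φ : End K V) - 1) ^ k) x) x = 0) (v w : V) :
    polar Q ((((φ : End K V) - 1) ^ k) w) v = polar Q ((((φ : End K V) - 1) ^ k) v) w := by
  have := hB (v + w)
  rw [map_add, polar_add_left, polar_add_right, polar_add_right, hB, hB, zero_add, add_zero] at this
  rw [eq_neg_of_add_eq_zero_right this, CharTwo.neg_eq]

theorem sub_one_pow_apply_zpow (φ : V ≃ₗ[K] V) {k : ℕ} (hN : ((φ : End K V) - 1) ^ (k + 1) = 0)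
    (i : ℤ) (x : V) : (((φ : End K V) - 1) ^ k) ((φ ^ i) x) = (((φ : End K V) - 1) ^ k) x := by
  obtain ⟨y, hy⟩ := zpow_apply_sub_mem_range φ i x
  rw [← sub_eq_zero, ← map_sub, ← hy, ← Module.End.mul_apply, ← pow_succ, hN,
    LinearMap.zero_apply]

section Pair

variable [CharP K 2] {Q : QuadraticForm K V} {φ : V ≃ₗ[K] V} {k : ℕ} {v w : V}

/-- The Gram matrix of the alternating form f(N^k x, y) on v, w has zero diagonal and equal nonzero
off-diagonal entries. -/
theorem gram_pair (hB : ∀ x, polar Q ((((φ : End K V) - 1) ^ k) x) x = 0)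
    (hvw : polar Q ((((φ : End K V) - 1) ^ k) v) w ≠ 0) (c : Bool → K)
    (hc : ∀ l, ∑ i, c i * polar Q ((((φ : End K V) - 1) ^ k) (cond i v w)) (cond l v w) = 0) :
    ∀ i, c i = 0 := by
  have h1 := hc true
  have h2 := hc false
  simp only [Fintype.sum_bool, cond_true, cond_false, hB, mul_zero, zero_add, add_zero,
    polar_sub_one_pow_swap hB v w, mul_eq_zero, hvw, or_false] at h1 h2
  rintro (_ | _) <;> assumption

theorem linearIndependent_pair (hφ : φ ∈ orthogonalGroup Q)
    (hN : ((φ : End K V) - 1) ^ (k + 1) = 0)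
    (hB : ∀ x, polar Q ((((φ : End K V) - 1) ^ k) x) x = 0)
    (hvw : polar Q ((((φ : End K V) - 1) ^ k) v) w ≠ 0) :
    LinearIndependent K fun x : Bool × Fin (k + 1) => (φ ^ (x.2 : ℕ)) (cond x.1 v w) :=
  linearIndependent_of_gram (u := fun b => cond b v w) hφ hN (gram_pair hB hvw)

theorem span_nat_pair (hφ : φ ∈ orthogonalGroup Q) (hind : IsOrthIndecomposable Q φ)
    (hN : ((φ : End K V) - 1) ^ (k + 1) = 0)
    (hB : ∀ x, polar Q ((((φ : End K V) - 1) ^ k) x) x = 0)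
    (hvw : polar Q ((((φ : End K V) - 1) ^ k) v) w ≠ 0) :
    Submodule.span K (Set.range fun x : Bool × ℕ => (φ ^ x.2) (cond x.1 v w)) = ⊤ :=
  span_eq_top_of_gram (u := fun b => cond b v w) hφ hind hN (gram_pair hB hvw)
    ⟨true, fun h => hvw (by rw [cond_true] at h; rw [h, map_zero, polar_zero_left])⟩

theorem span_pair (hφ : φ ∈ orthogonalGroup Q) (hind : IsOrthIndecomposable Q φ)
    (hN : ((φ : End K V) - 1) ^ (k + 1) = 0)
    (hB : ∀ x, polar Q ((((φ : End K V) - 1) ^ k) x) x = 0)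
    (hvw : polar Q ((((φ : End K V) - 1) ^ k) v) w ≠ 0) :
    Submodule.span K (Set.range fun x : Bool × ℤ => (φ ^ x.2) (cond x.1 v w)) = ⊤ := by
  rw [eq_top_iff, ← span_nat_pair hφ hind hN hB hvw]
  refine Submodule.span_mono ?_
  rintro _ ⟨x, rfl⟩
  exact ⟨(x.1, x.2), by simp⟩

theorem span_fin_pair (hφ : φ ∈ orthogonalGroup Q) (hind : IsOrthIndecomposable Q φ)
    (hN : ((φ : End K V) - 1) ^ (k + 1) = 0)
    (hB : ∀ x, polar Q ((((φ : End K V) - 1) ^ k) x) x = 0)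
    (hvw : polar Q ((((φ : End K V) - 1) ^ k) v) w ≠ 0) :
    Submodule.span K
      (Set.range fun x : Bool × Fin (k + 1) => (φ ^ (x.2 : ℕ)) (cond x.1 v w)) = ⊤ :=
  span_fin_eq_top (u := fun b => cond b v w) (span_nat_pair hφ hind hN hB hvw)
    (monic_sub_one_pow (k + 1)) (by rw [aeval_sub_one_pow, hN]) (natDegree_sub_one_pow _)

theorem finrank_of_pair (hφ : φ ∈ orthogonalGroup Q) (hind : IsOrthIndecomposable Q φ)
    (hN : ((φ : End K V) - 1) ^ (k + 1) = 0)
    (hB : ∀ x, polar Q ((((φ : End K V) - 1) ^ k) x) x = 0)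
    (hvw : polar Q ((((φ : End K V) - 1) ^ k) v) w ≠ 0) : finrank K V = 2 * (k + 1) := by
  have := finrank_span_eq_card (linearIndependent_pair hφ hN hB hvw)
  rw [span_fin_pair hφ hind hN hB hvw, finrank_top] at this
  simpa using this

end Pair

/-! ### Two blocks: reversing both orbits -/

section Bicyclic

variable [CharP K 2] {Q : QuadraticForm K V} {φ : V ≃ₗ[K] V} {k : ℕ}

theorem linearIndependent_orbit (hQ : IsNondefective Q) (hφ : φ ∈ orthogonalGroup Q)
    (hN : ((φ : End K V) - 1) ^ (k + 1) = 0)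
    (hB : ∀ x, polar Q ((((φ : End K V) - 1) ^ k) x) x = 0) {v : V}
    (hv : (((φ : End K V) - 1) ^ k) v ≠ 0) :
    LinearIndependent K fun i : Fin (k + 1) => (φ ^ (i : ℕ)) v := by
  obtain ⟨w, hw⟩ : ∃ w, polar Q ((((φ : End K V) - 1) ^ k) v) w ≠ 0 := by
    by_contra! h
    exact hv (hQ.eq_zero_of_polar h)
  exact (linearIndependent_pair hφ hN hB hw).comp (fun i => (true, i)) fun i j h => by simpa using h

/-- Choosing w dual to the start of the orbit of v makes f(φ^i v, w) symmetric under i ↦ k + 1 - i.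
Replacing w by φ^(-n) w then moves the centre of symmetry. -/
theorem exists_symmetric_pair [FiniteDimensional K V] (hQ : IsNondefective Q)
    (hφ : φ ∈ orthogonalGroup Q)
    (hN : ((φ : End K V) - 1) ^ (k + 1) = 0) (hN' : ((φ : End K V) - 1) ^ k ≠ 0)
    (hB : ∀ x, polar Q ((((φ : End K V) - 1) ^ k) x) x = 0) (n : ℕ) :
    ∃ v w, polar Q ((((φ : End K V) - 1) ^ k) v) w ≠ 0 ∧
      ∀ i : ℤ, polar Q ((φ ^ i) v) w = polar Q ((φ ^ ((k + 1 : ℤ) - 2 * n - i)) v) w := by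
  obtain ⟨v, hv⟩ : ∃ v, (((φ : End K V) - 1) ^ k) v ≠ 0 := by
    by_contra! h
    exact hN' (LinearMap.ext h)
  obtain ⟨w, hw⟩ := hQ.exists_polar_eq (linearIndependent_orbit hQ hφ hN hB hv)
    (fun i => if (i : ℕ) = 0 then 1 else 0)
  have hw' : ∀ i : ℕ, i < k + 1 → polar Q ((φ ^ i) v) w = if i = 0 then 1 else 0 :=
    fun i hi => hw ⟨i, hi⟩
  have hvw : polar Q ((((φ : End K V) - 1) ^ k) v) w = 1 := by
    rw [polar_sub_one_pow_apply, Finset.sum_eq_single 0]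
    · rw [hw' 0 (by omega)]; simp
    · intro i hi hi0
      rw [hw' i (Finset.mem_range.1 hi), if_neg hi0, mul_zero]
    · simp
  have hrec := binomialRecurrent_polar Q hN v w
  have hlast : polar Q ((φ ^ (k + 1)) v) w = 1 := by
    have h := polar_sub_one_pow_apply Q φ (k + 1) v w
    rw [hN, LinearMap.zero_apply, polar_zero_left, Finset.sum_range_succ,
      Finset.sum_eq_single 0] at h
    · rw [hw' 0 (by omega)] at h
      simp only [Nat.choose_zero_right, Nat.cast_one, if_true, mul_one, Nat.choose_self,
        one_mul] at h
      rw [eq_neg_of_add_eq_zero_right h.symm, CharTwo.neg_eq]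
    · intro i hi hi0
      rw [hw' i (Finset.mem_range.1 hi), if_neg hi0, mul_zero]
    · simp
  have hsymm : ∀ i : ℤ, polar Q ((φ ^ i) v) w = polar Q ((φ ^ ((k + 1 : ℤ) - i)) v) w := by
    intro i
    have h := (hrec.add (hrec.reflect (k + 1))).eq_zero (s := 0) (fun i hi => ?_) i
    · rw [eq_neg_of_add_eq_zero_left h, CharTwo.neg_eq]
    · obtain ⟨j, hj⟩ : ∃ j : ℕ, (j : ℤ) = k + 1 - (0 + i) := ⟨k + 1 - i, by omega⟩
      rw [← hj, zero_add, zpow_natCast, zpow_natCast, hw' i hi]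
      rcases Nat.eq_zero_or_pos i with rfl | hi0
      · rw [show j = k + 1 by omega, hlast, if_pos rfl, CharTwo.add_self_eq_zero]
      · rw [hw' j (by omega), if_neg (by omega), if_neg (by omega), add_zero]
  refine ⟨v, (φ ^ (-(n : ℤ))) w, ?_, fun i => ?_⟩
  · rw [← polar_sub_one_pow_swap hB, sub_one_pow_apply_zpow φ hN, polar_sub_one_pow_swap hB, hvw]
    exact one_ne_zero
  · rw [polar_zpow hφ, polar_zpow hφ, hsymm]
    congr 3
    ring

/-- The involution that reverses both orbits. -/
theorem exists_diagonal_involution [FiniteDimensional K V] (hQ : IsNondefective Q)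
    (hφ : φ ∈ orthogonalGroup Q)
    (hind : IsOrthIndecomposable Q φ)
    (hN : ((φ : End K V) - 1) ^ (k + 1) = 0) (hN' : ((φ : End K V) - 1) ^ k ≠ 0)
    (hB : ∀ x, polar Q ((((φ : End K V) - 1) ^ k) x) x = 0) :
    ∃ σ ∈ orthogonalGroup Q, IsInvolution σ ∧ Inverts σ φ ∧
      2 * finrank K (fix σ) = finrank K V + 2 * ((k + 1) % 2) := by
  set n := (k + 1) / 2 with hn
  obtain ⟨v, w, hvw, hsymm⟩ := exists_symmetric_pair hQ hφ hN hN' hB n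
  have hspan := span_pair hφ hind hN hB hvw
  -- The exponent sums k for v and 2n - 1 for w differ by k + 1 - 2n, the symmetry built into the
  -- pair. Only k can be even, namely when k + 1 = 2n + 1; then φ^n v is fixed.
  obtain ⟨σ, hσ, h1, h2, h3⟩ := exists_reversing_involution hQ hφ (fun b => cond b v w) id
    (fun b => cond b (k : ℤ) (2 * n - 1)) hspan (fun _ => rfl) (fun _ => rfl) (fun _ => rfl) (by
      rintro (_ | _) (_ | _) i <;> simp only [cond_true, cond_false, id]
      · rw [sub_self, zero_sub, polar_zpow_comm hφ]
      · rw [polar_zpow_comm hφ, hsymm, polar_zpow_comm hφ _ w]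
        congr 3
        ring
      · rw [hsymm]
        congr 3
        ring
      · rw [sub_self, zero_sub, polar_zpow_comm hφ])
  refine ⟨σ, hσ, h1, h2, ?_⟩
  have h4 := card_mul_add_finrank_fix_le (h := n) (u := fun b => cond b v w)
    (linearIndependent_pair hφ hN hB hvw) h3
    (by rintro (_ | _) <;> simp only [cond_true, cond_false] <;> omega) (by omega)
  have h5 := h1.finrank_le
  rw [Fintype.card_bool] at h4
  rw [finrank_of_pair hφ hind hN hB hvw] at h4 h5 ⊢
  rcases Nat.mod_two_eq_zero_or_one (k + 1) with h | h
  · omega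
  · have hr := range_sub_one_le (u := fun b => cond b v w) hspan h3
    have h6 := h1.finrank_lt (u := (φ ^ (n : ℤ)) v) (by
        have := h3 true n
        simp only [cond_true, id] at this
        rw [this]
        congr 2
        omega) fun hmem => by
      obtain ⟨z, hz⟩ := hr hmem
      have := sub_one_pow_apply_zpow φ hN n v
      rw [← hz, ← Module.End.mul_apply, ← pow_succ, hN, LinearMap.zero_apply] at this
      rw [← this, polar_zero_left] at hvw
      exact hvw rfl
    rw [finrank_of_pair hφ hind hN hB hvw] at h6
    omega

end Bicyclic

/-! ### Two blocks of odd size: exchanging orbits -/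

section OddBlocks

variable [CharP K 2] {Q : QuadraticForm K V} {φ : V ≃ₗ[K] V} {n : ℕ}

/-- Choose x, y with f(N^n x, N^n y) ≠ 0. Then Q cannot vanish at N^n x, N^n y and their sum, so one
of x, y, x + y works. -/
theorem exists_nonsingular (hQ : IsNondefective Q) (hφ : φ ∈ orthogonalGroup Q)
    (hN' : ((φ : End K V) - 1) ^ (2 * n) ≠ 0) :
    ∃ v, (((φ : End K V) - 1) ^ (2 * n)) v ≠ 0 ∧ Q ((((φ : End K V) - 1) ^ n) v) ≠ 0 := by
  set N := (φ : End K V) - 1 with hNdef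
  have hNN : ∀ x y, polar Q ((N ^ (2 * n)) x) ((φ ^ n) y) = polar Q ((N ^ n) x) ((N ^ n) y) := by
    intro x y
    rw [two_mul, pow_add, Module.End.mul_apply, polar_sub_one_pow hφ]
  obtain ⟨x, hx⟩ : ∃ x, (N ^ (2 * n)) x ≠ 0 := by
    by_contra! h
    exact hN' (LinearMap.ext h)
  obtain ⟨y, hy⟩ : ∃ y, polar Q ((N ^ n) x) ((N ^ n) y) ≠ 0 := by
    by_contra! h
    refine hx (hQ.eq_zero_of_polar fun y => ?_)
    obtain ⟨y, rfl⟩ := (φ ^ n).surjective y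
    rw [hNN, h]
  have hne : ∀ a b, polar Q ((N ^ n) a) ((N ^ n) b) ≠ 0 → (N ^ (2 * n)) a ≠ 0 := by
    intro a b hab h
    rw [← hNN, h, polar_zero_left] at hab
    exact hab rfl
  by_cases h1 : Q ((N ^ n) x) = 0
  · by_cases h2 : Q ((N ^ n) y) = 0
    · refine ⟨x + y, hne _ x ?_, ?_⟩
      · rwa [map_add, polar_add_left, polar_self_eq_zero, zero_add, polar_comm]
      · rwa [map_add, QuadraticMap.map_add Q, h1, h2, zero_add, zero_add]
    · exact ⟨y, hne y x (by rwa [polar_comm]), h2⟩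
  · exact ⟨x, hx, h1⟩

/-- A relation between `v` and `w` that passes to `(φ - 1) v` and `(φ - 1) w`. -/
theorem map_sub_one_pow_eq_polar (hφ : φ ∈ orthogonalGroup Q) {v w : V}
    (h : ∀ i : ℤ, polar Q ((φ ^ i) v) w + polar Q ((φ ^ (-i)) v) w = polar Q ((φ ^ i) v) v)
    (h0 : Q v = polar Q v w) (j : ℕ) :
    Q ((((φ : End K V) - 1) ^ j) v) =
      polar Q ((((φ : End K V) - 1) ^ j) v) ((((φ : End K V) - 1) ^ j) w) := by
  induction j generalizing v w with
  | zero => exact h0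
  | succ j ih =>
    simp only [pow_succ, Module.End.mul_apply]
    have hadd : ∀ x, ((φ : End K V) - 1) x = φ x + x := fun x => by
      rw [LinearMap.sub_apply, sub_eq_iff_eq_add, add_assoc]
      simp [add_self_eq_zero_of_char_two K]
    have hφ1 : ∀ (i : ℤ) x, (φ ^ i) (φ x) = (φ ^ (i + 1)) x := fun i x => by
      rw [zpow_add_one, LinearEquiv.mul_apply]
    have hr : ∀ (i : ℤ) x y, polar Q ((φ ^ i) x) (φ y) = polar Q ((φ ^ (i - 1)) x) y :=
      fun i x y => by
        have := polar_zpow hφ i 1 x y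
        rwa [zpow_one] at this
    have hexp : ∀ (i : ℤ) y, polar Q ((φ ^ i) (((φ : End K V) - 1) v)) (((φ : End K V) - 1) y) =
        polar Q ((φ ^ (i + 1)) v) y + polar Q ((φ ^ (i - 1)) v) y := by
      intro i y
      rw [hadd, hadd, map_add, hφ1, polar_add_left, polar_add_right, polar_add_right, hr, hr,
        add_sub_cancel_right]
      linear_combination (polar Q ((φ ^ i) v) y) * CharTwo.two_eq_zero (R := K)
    apply ih
    · intro i
      rw [hexp, hexp, hexp, ← h, ← h]
      rw [show -i + 1 = -(i - 1) by ring, show -i - 1 = -(i + 1) by ring]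
      ring
    · have h1 := hexp 0 w
      rw [zpow_zero, LinearEquiv.coe_one, id, zero_add, zero_sub, h] at h1
      have hQφ : Q (φ v) = Q v := hφ v
      rw [h1, hadd, QuadraticMap.map_add Q, hQφ, zpow_one, CharTwo.add_self_eq_zero, zero_add]

/-- The last two conditions say exactly what is needed for w and v + w to have the same Gram data.
They force f(N^(2n) v, w) = Q(N^n v), so nondegeneracy follows from the choice of v. -/
theorem exists_swap_pair [FiniteDimensional K V] (hQ : IsNondefective Q)
    (hφ : φ ∈ orthogonalGroup Q)
    (hN : ((φ : End K V) - 1) ^ (2 * n + 1) = 0) (hN' : ((φ : End K V) - 1) ^ (2 * n) ≠ 0)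
    (hB : ∀ x, polar Q ((((φ : End K V) - 1) ^ (2 * n)) x) x = 0) :
    ∃ v w, polar Q ((((φ : End K V) - 1) ^ (2 * n)) v) w ≠ 0 ∧ Q v = polar Q v w ∧
      ∀ i : ℤ, polar Q ((φ ^ i) v) w + polar Q ((φ ^ (-i)) v) w = polar Q ((φ ^ i) v) v := by
  obtain ⟨v, hv, hQv⟩ := exists_nonsingular hQ hφ hN'
  -- Pairings are prescribed for exponents -n, …, n: the positive half carries all of f(φ^i v, v),
  -- the negative half is 0, and the centre is Q v. The recurrence extends the relation to all
  -- exponents.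
  obtain ⟨w, hw⟩ := hQ.exists_polar_eq (linearIndependent_orbit hQ hφ hN hB
    (v := (φ ^ (-(n : ℤ))) v) (by rwa [sub_one_pow_apply_zpow φ hN]))
    (fun i => if (i : ℕ) = n then Q v else
      if n < (i : ℕ) then polar Q ((φ ^ ((i : ℤ) - n)) v) v else 0)
  have hw' : ∀ i : ℤ, -n ≤ i → i ≤ n → polar Q ((φ ^ i) v) w =
      if i = 0 then Q v else if 0 < i then polar Q ((φ ^ i) v) v else 0 := by
    intro i h1 h2
    obtain ⟨j, rfl⟩ : ∃ j : ℕ, i = j - n := ⟨(i + n).toNat, by omega⟩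
    have := hw ⟨j, by omega⟩
    simp only at this
    rw [← zpow_natCast, zpow_apply_zpow_apply, ← sub_eq_add_neg] at this
    rw [this]
    split_ifs <;> first | rfl | omega
  have hcomm : ∀ i : ℤ, polar Q ((φ ^ (-i)) v) v = polar Q ((φ ^ i) v) v := fun i => by
    rw [polar_zpow_comm hφ, neg_neg]
  have hrec := binomialRecurrent_polar Q hN v
  have hsymm : ∀ i : ℤ,
      polar Q ((φ ^ i) v) w + polar Q ((φ ^ (-i)) v) w = polar Q ((φ ^ i) v) v := by
    intro i
    have h := (((hrec w).add ((hrec w).reflect 0)).add (hrec v)).eq_zero (s := -n)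
      (fun i hi => ?_) i
    · rw [zero_sub] at h
      rw [eq_neg_of_add_eq_zero_left h, CharTwo.neg_eq]
    · generalize hj : -(n : ℤ) + i = j
      rw [zero_sub, hw' j (by omega) (by omega), hw' (-j) (by omega) (by omega)]
      rcases lt_trichotomy j 0 with h | h | h
      · rw [if_neg (by omega), if_neg (by omega), if_neg (by omega), if_pos (by omega), hcomm,
          zero_add, CharTwo.add_self_eq_zero]
      · rw [if_pos h, if_pos (by omega), CharTwo.add_self_eq_zero, zero_add, h, zpow_zero]
        exact polar_self_eq_zero Q v
      · rw [if_neg (by omega), if_pos h, if_neg (by omega), if_neg (by omega), add_zero,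
          CharTwo.add_self_eq_zero]
  have h0 : Q v = polar Q v w := by
    have := hw' 0 (by omega) (by omega)
    rw [if_pos rfl, zpow_zero] at this
    exact this.symm
  refine ⟨v, w, ?_, h0, hsymm⟩
  rw [map_sub_one_pow_eq_polar hφ hsymm h0, ← polar_sub_one_pow hφ, ← Module.End.mul_apply,
    ← pow_add, ← two_mul, polar_pow_right_of_apply_eq hφ] at hQv
  · exact hQv
  · rw [← sub_one_apply_eq_zero, ← Module.End.mul_apply, ← pow_succ', hN, LinearMap.zero_apply]

/-- The involution that exchanges the orbits of `w` and `v + w`. -/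
theorem exists_swap_involution [FiniteDimensional K V] (hQ : IsNondefective Q)
    (hφ : φ ∈ orthogonalGroup Q)
    (hind : IsOrthIndecomposable Q φ)
    (hN : ((φ : End K V) - 1) ^ (2 * n + 1) = 0) (hN' : ((φ : End K V) - 1) ^ (2 * n) ≠ 0)
    (hB : ∀ x, polar Q ((((φ : End K V) - 1) ^ (2 * n)) x) x = 0) :
    ∃ σ ∈ orthogonalGroup Q, IsInvolution σ ∧ Inverts σ φ ∧
      2 * finrank K (fix σ) = finrank K V := by
  obtain ⟨v, w, hvw, h0, hsymm⟩ := exists_swap_pair hQ hφ hN hN' hB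
  have hww : polar Q ((((φ : End K V) - 1) ^ (2 * n)) w) (v + w) ≠ 0 := by
    rwa [polar_add_right, hB, add_zero, polar_sub_one_pow_swap hB]
  have hself : ∀ i : ℤ, polar Q ((φ ^ i) (v + w)) (v + w) = polar Q ((φ ^ i) w) w := by
    intro i
    rw [map_add, polar_add_left, polar_add_right, polar_add_right, polar_zpow_comm hφ i w v]
    linear_combination hsymm i + (polar Q ((φ ^ i) v) v) * CharTwo.two_eq_zero (R := K)
  have hQw : Q (v + w) = Q w := by
    rw [QuadraticMap.map_add Q, ← h0]
    linear_combination (Q v) * CharTwo.two_eq_zero (R := K)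
  obtain ⟨σ, hσ, h1, h2, h3⟩ := exists_reversing_involution hQ hφ (fun b => cond b w (v + w))
    Bool.not (fun _ => ((2 * n : ℕ) : ℤ)) (span_pair hφ hind hN hB hww) Bool.not_not
    (fun _ => rfl) (by rintro (_ | _) <;> simp [hQw]) (by
      rintro (_ | _) (_ | _) i <;>
        simp only [cond_true, cond_false, Bool.not_true, Bool.not_false, sub_self, zero_sub]
      · rw [hself, polar_zpow_comm hφ]
      · rw [polar_zpow_comm hφ]
      · rw [polar_zpow_comm hφ]
      · rw [hself, polar_zpow_comm hφ])
  refine ⟨σ, hσ, h1, h2, ?_⟩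
  -- The reflection i ↦ 2n - i maps 0, …, 2n to itself, so the whole basis half from w is carried
  -- onto the half from v + w.
  have h4 := card_add_finrank_fix_le (σ := σ) (linearIndependent_pair hφ hN hB hww)
    ({true} ×ˢ Finset.univ) (by
      rintro ⟨b, i⟩ hi
      obtain rfl : b = true := by simpa using hi
      refine ⟨(false, ⟨2 * n - i, by omega⟩), by simp, ?_⟩
      have := h3 true (i : ℕ)
      rw [← Nat.cast_sub (by omega), zpow_natCast, zpow_natCast] at this
      exact this)
  have h5 := h1.finrank_le
  rw [Finset.card_product, Finset.card_singleton, one_mul, Finset.card_univ, Fintype.card_fin] at h4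
  rw [finrank_of_pair hφ hind hN hB hww] at h4 h5 ⊢
  omega

end OddBlocks

/-! ### Orthogonally indecomposable isometries are cyclic or unipotent -/

theorem polar_symm_left {Q : QuadraticForm K V} {φ : V ≃ₗ[K] V} (hφ : φ ∈ orthogonalGroup Q)
    (x y : V) : polar Q (φ.symm x) y = polar Q x (φ y) := by
  rw [← polar_map hφ, LinearEquiv.apply_symm_apply]

/-- A self-adjoint endomorphism commuting with `φ` is nilpotent or injective. -/
theorem isNilpotent_or_injective [FiniteDimensional K V] {Q : QuadraticForm K V}
    (hQ : IsNondefective Q) {φ : V ≃ₗ[K] V} (hind : IsOrthIndecomposable Q φ) {a : End K V}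
    (ha : ∀ x y, polar Q (a x) y = polar Q x (a y)) (haφ : Commute a (φ : End K V)) :
    IsNilpotent a ∨ Function.Injective a := by
  -- Fitting decomposition; self-adjointness makes kernel and range orthogonal, so the kernel is
  -- nondefective.
  obtain ⟨n, hn, hn0⟩ := (a.eventually_isCompl_ker_pow_range_pow.and
    (Filter.eventually_ge_atTop 1)).exists
  have han : ∀ j x y, polar Q ((a ^ j) x) y = polar Q x ((a ^ j) y) := by
    intro j
    induction j with
    | zero => exact fun _ _ => rfl
    | succ j ih =>
      intro x y
      rw [pow_succ', Module.End.mul_apply, ha, ih, ← Module.End.mul_apply, ← pow_succ, pow_succ']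
  have hinv : IsInvariant φ (LinearMap.ker (a ^ n)) := by
    intro x hx
    rw [LinearMap.mem_ker] at hx ⊢
    have := congr($((haφ.pow_left n).eq) x)
    rw [Module.End.mul_apply, Module.End.mul_apply, hx, map_zero] at this
    exact this
  have hnd : IsNondefective (Q.restrict (LinearMap.ker (a ^ n))) := by
    refine isNondefective_restrict fun x hx h => hQ.eq_zero_of_polar fun y => ?_
    have hy : y ∈ LinearMap.ker (a ^ n) ⊔ LinearMap.range (a ^ n) := by
      rw [hn.sup_eq_top]; trivial
    obtain ⟨y, hy', _, ⟨z, rfl⟩, rfl⟩ := Submodule.mem_sup.1 hy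
    rw [polar_add_right, h y hy', ← han, LinearMap.mem_ker.1 hx, polar_zero_left, add_zero]
  rcases hind _ hinv hnd with h | h
  · right
    have h' : Function.Injective (a ^ n) := LinearMap.ker_eq_bot.1 h
    rw [← Nat.sub_add_cancel hn0, pow_succ] at h'
    exact Function.Injective.of_comp (f := (a ^ (n - 1))) h'
  · exact .inl ⟨n, LinearMap.ker_eq_top.1 h⟩

theorem IsInvariant.symm_apply_mem [FiniteDimensional K V] {φ : V ≃ₗ[K] V} {W : Submodule K V}
    (hW : IsInvariant φ W) {x : V} (hx : x ∈ W) : φ.symm x ∈ W := by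
  have hle : W.map (φ : V →ₗ[K] V) ≤ W := by
    rintro _ ⟨y, hy, rfl⟩
    exact hW y hy
  have heq := Submodule.eq_of_le_of_finrank_eq hle (LinearEquiv.finrank_map_eq φ W)
  rw [← heq] at hx
  obtain ⟨y, hy, rfl⟩ := hx
  simpa using hy

theorem isCyclic_of_span_nat {φ : V ≃ₗ[K] V} {u : V}
    (h : Submodule.span K (Set.range fun x : Unit × ℕ => (φ ^ x.2) u) = ⊤) : IsCyclic φ := by
  refine ⟨u, ?_⟩
  rw [eq_top_iff, ← h]
  refine Submodule.span_mono ?_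
  rintro _ ⟨x, rfl⟩
  exact ⟨x.2, rfl⟩

theorem isInvariant_span_pow (φ : V ≃ₗ[K] V) (u : V) :
    IsInvariant φ (Submodule.span K (Set.range fun k : ℕ => (φ ^ k) u)) := by
  intro x hx
  induction hx using Submodule.span_induction with
  | mem x hx =>
    obtain ⟨k, rfl⟩ := hx
    exact Submodule.subset_span ⟨k + 1, by simp only [pow_succ']; rfl⟩
  | zero => simp
  | add x y _ _ hx hy => rw [map_add]; exact add_mem hx hy
  | smul c x _ hx => rw [map_smul]; exact Submodule.smul_mem _ _ hx

/-- Modulo a power of an irreducible polynomial, every nonzero class divides the last power. -/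
theorem exists_aeval_mul_eq {A : Type*} [Ring A] [Algebra K A] {a : A} {p : K[X]}
    (hp : Irreducible p) {s : ℕ} (hs : aeval a (p ^ (s + 1)) = 0) {b : K[X]} (hb : aeval a b ≠ 0) :
    ∃ c : K[X], aeval a (b * c) = aeval a (p ^ s) := by
  classical
  obtain ⟨i, hi, h⟩ := (dvd_prime_pow hp.prime (s + 1)).1
    (EuclideanDomain.gcd_dvd_right b (p ^ (s + 1)))
  have his : i ≤ s := by
    by_contra! his
    obtain rfl : i = s + 1 := by omega
    obtain ⟨r, hr⟩ := h.symm.dvd.trans (EuclideanDomain.gcd_dvd_left b (p ^ (s + 1)))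
    exact hb (by rw [hr, map_mul, hs, zero_mul])
  obtain ⟨e, he⟩ := h
  rw [EuclideanDomain.gcd_eq_gcd_ab] at he
  refine ⟨EuclideanDomain.gcdA b (p ^ (s + 1)) * e * p ^ (s - i), ?_⟩
  have : b * (EuclideanDomain.gcdA b (p ^ (s + 1)) * e * p ^ (s - i)) = p ^ s -
      p ^ (s + 1) * (EuclideanDomain.gcdB b (p ^ (s + 1)) * e * p ^ (s - i)) := by
    rw [← Nat.add_sub_cancel' his, pow_add p i (s - i), ← he, Nat.add_sub_cancel' his]
    ring
  rw [this, map_sub, map_mul, hs, zero_mul, sub_zero]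

section

variable [CharP K 2] {Q : QuadraticForm K V} {φ : V ≃ₗ[K] V}

/-- In characteristic 2, (φ - 1)² = φ² + 1 = φ(φ + φ⁻¹). -/
theorem isUnipotent_of_isNilpotent_add_symm
    (h : IsNilpotent ((φ : End K V) + (φ.symm : End K V))) : IsUnipotent φ := by
  have h1 : (φ : End K V) * (φ.symm : End K V) = 1 := by ext; simp
  have h2 : (φ.symm : End K V) * (φ : End K V) = 1 := by ext; simp
  have hc : Commute (φ : End K V) ((φ : End K V) + (φ.symm : End K V)) := by
    rw [Commute, SemiconjBy, mul_add, add_mul, h1, h2]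
  have hsq : ((φ : End K V) - 1) ^ 2 = (φ : End K V) * ((φ : End K V) + (φ.symm : End K V)) := by
    have h3 : (φ : End K V) + φ = 0 := LinearMap.ext fun x => add_self_eq_zero_of_char_two K _
    rw [mul_add, h1, pow_two, sub_mul, mul_sub, one_mul, mul_one,
      ← sub_zero ((φ : End K V) * φ + 1),
      ← h3]
    abel
  obtain ⟨k, hk⟩ : IsNilpotent (((φ : End K V) - 1) ^ 2) := hsq ▸ hc.isNilpotent_mul_left h
  exact ⟨2 * k, by rw [pow_mul, hk]⟩

/-- Put y = φ + φ⁻¹. Some irreducible p has p(y) nilpotent; let G = p(y)^s be its last nonzero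
power. For u with f(Gφu, u) ≠ 0, the subspace K[y]u + K[y]φu is invariant and nondefective, hence V,
and it lies in K[φ]u. -/
theorem isCyclic_of_injective_add_symm [FiniteDimensional K V] [Nontrivial V]
    (hQ : IsNondefective Q) (hφ : φ ∈ orthogonalGroup Q) (hind : IsOrthIndecomposable Q φ)
    (hinj : Function.Injective ((φ : End K V) + (φ.symm : End K V))) : IsCyclic φ := by
  set y : End K V := (φ : End K V) + (φ.symm : End K V) with hy
  have hyapp : ∀ x, y x = φ x + φ.symm x := fun x => rfl
  have hadj : ∀ (c : K[X]) a b, polar Q (aeval y c a) b = polar Q a (aeval y c b) := by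
    intro c
    induction c using Polynomial.induction_on with
    | C r => intro a b; simp [polar_smul_left, polar_smul_right]
    | add p q hp hq =>
      intro a b
      rw [map_add, LinearMap.add_apply, LinearMap.add_apply, polar_add_left, polar_add_right, hp,
        hq]
    | monomial n r ih =>
      intro a b
      rw [pow_succ, ← mul_assoc, map_mul, aeval_X, Module.End.mul_apply, Module.End.mul_apply, ih]
      have : Commute (aeval y (C r * X ^ n)) y := by
        have := (Commute.all (C r * X ^ n) X).map (aeval (R := K) y)
        rwa [aeval_X] at this
      rw [← Module.End.mul_apply, this.eq, Module.End.mul_apply, hyapp, hyapp, polar_add_left,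
        polar_add_right, polar_symm_left hφ, polar_comm Q (φ a), ← polar_symm_left hφ,
        polar_comm Q _ a, add_comm]
  have hcφ : ∀ c : K[X], Commute (aeval y c) (φ : End K V) := by
    have h1 : Commute y (φ : End K V) := by
      ext x; simp [hyapp]
    intro c
    induction c using Polynomial.induction_on with
    | C r => rw [aeval_C]; exact Algebra.commutes r _
    | add p q hp hq => rw [map_add]; exact hp.add_left hq
    | monomial n r ih =>
      rw [pow_succ, ← mul_assoc, map_mul, aeval_X]; exact ih.mul_left h1
  have hcφ' : ∀ (c : K[X]) x, aeval y c (φ x) = φ (aeval y c x) := fun c x => congr($((hcφ c).eq) x)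
  have hmul : ∀ (c d : K[X]) x, aeval y c (aeval y d x) = aeval y (c * d) x := fun c d x => by
    rw [map_mul, Module.End.mul_apply]
  -- Half of each power of y moves across. What remains is f(z, z) or f(yz, z) = 2f(φz, z), both
  -- zero.
  have halt : ∀ (c : K[X]) u, polar Q (aeval y c u) u = 0 := by
    intro c u
    induction c using Polynomial.induction_on' with
    | add p q hp hq => rw [map_add, LinearMap.add_apply, polar_add_left, hp, hq, add_zero]
    | monomial n r =>
      rw [← C_mul_X_pow_eq_monomial, map_mul, aeval_C, Module.End.mul_apply,
        Module.algebraMap_end_apply, polar_smul_left]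
      obtain ⟨j, rfl | rfl⟩ := Nat.even_or_odd' n
      · rw [two_mul, pow_add, ← hmul, hadj, polar_self_eq_zero, smul_zero]
      · rw [show 2 * j + 1 = j + (1 + j) by ring, pow_add, pow_add, pow_one, ← hmul, ← hmul, hadj,
          aeval_X, hyapp, polar_add_left, polar_symm_left hφ, polar_comm Q _ (φ _),
          CharTwo.add_self_eq_zero, smul_zero]
  obtain ⟨p, hp, q, hq⟩ := WfDvdMonoid.exists_irreducible_factor (minpoly.not_isUnit K y)
    (minpoly.ne_zero (Algebra.IsIntegral.isIntegral y))
  have hnil : IsNilpotent (aeval y p) := by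
    refine (isNilpotent_or_injective hQ hind (hadj p) (hcφ p)).resolve_right fun h => ?_
    have hq0 : aeval y q = 0 := by
      refine LinearMap.ext fun x => h ?_
      rw [LinearMap.zero_apply, map_zero, hmul, ← hq, minpoly.aeval, LinearMap.zero_apply]
    have hM := minpoly.ne_zero (A := K) (Algebra.IsIntegral.isIntegral y)
    have hqne : q ≠ 0 := by rintro rfl; rw [mul_zero] at hq; exact hM hq
    have hdeg := natDegree_le_of_dvd (minpoly.dvd K y hq0) hqne
    rw [hq, natDegree_mul hp.ne_zero hqne] at hdeg
    have := hp.natDegree_pos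
    omega
  obtain ⟨s, hs, hs'⟩ : ∃ s, aeval y (p ^ (s + 1)) = 0 ∧ aeval y (p ^ s) ≠ 0 := by
    classical
    have hex : ∃ t, aeval y (p ^ t) = 0 := by
      obtain ⟨t, ht⟩ := hnil
      exact ⟨t, by rw [map_pow, ht]⟩
    have hpos : Nat.find hex ≠ 0 := by
      intro h
      have := Nat.find_spec hex
      rw [h, pow_zero, map_one] at this
      exact one_ne_zero this
    refine ⟨Nat.find hex - 1, ?_, Nat.find_min hex (by omega)⟩
    rw [Nat.sub_add_cancel (by omega)]
    exact Nat.find_spec hex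
  set G := aeval y (p ^ s)
  -- Otherwise polarization gives f(yGx, w) = 0 for all x, w, so yG = 0 and G = 0 by injectivity of
  -- y.
  obtain ⟨u, hu⟩ : ∃ u, polar Q (G (φ u)) u ≠ 0 := by
    by_contra! h
    refine hs' (LinearMap.ext fun x => hinj ?_)
    rw [LinearMap.zero_apply, map_zero]
    refine hQ.eq_zero_of_polar fun w => ?_
    have := h (x + w)
    rw [map_add, map_add, polar_add_left, polar_add_right, polar_add_right, h, h, zero_add,
      add_zero] at this
    rw [hyapp, polar_add_left, ← this, ← hcφ', polar_symm_left hφ, hadj, hadj, hadj,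
      polar_comm Q x, hadj]
  let F : (K[X] × K[X]) →ₗ[K] V :=
    (LinearMap.applyₗ u ∘ₗ (aeval y).toLinearMap).coprod
      (LinearMap.applyₗ (φ u) ∘ₗ (aeval y).toLinearMap)
  have hF : ∀ a b, F (a, b) = aeval y a u + aeval y b (φ u) := fun a b => rfl
  have hu0 : u ≠ 0 := by
    rintro rfl
    rw [polar_zero_right] at hu
    exact hu rfl
  have hzero : ∀ b : K[X], (∀ c : K[X], polar Q (aeval y (b * c) (φ u)) u = 0) →
      aeval y b = 0 := by
    intro b hb
    by_contra hb0
    obtain ⟨c, hc⟩ := exists_aeval_mul_eq hp hs hb0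
    have := hb c
    rw [hc] at this
    exact hu this
  have htop : LinearMap.range F = ⊤ := by
    refine (hind _ ?_ (isNondefective_restrict ?_)).resolve_left fun h => hu0 ?_
    · rintro _ ⟨⟨a, b⟩, rfl⟩
      -- From φ²u = yφu - u.
      refine ⟨(-b, a + X * b), ?_⟩
      rw [hF, hF, map_add (aeval y), LinearMap.add_apply, ← hmul, aeval_X, hyapp, map_neg,
        LinearMap.neg_apply, map_add φ, hcφ', hcφ', φ.symm_apply_apply]
      abel
    · rintro _ ⟨⟨a, b⟩, rfl⟩ h
      -- Pairing with K[y]u kills the a-term by `halt` and isolates b; pairing with K[y]φu then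
      -- isolates a.
      have hb : aeval y b = 0 := hzero b fun c => by
        have := h _ ⟨(c, 0), rfl⟩
        rwa [hF, hF, map_zero, LinearMap.zero_apply, add_zero, polar_add_left, ← hadj, ← hadj, hmul,
          hmul, halt, zero_add, mul_comm] at this
      have ha : aeval y a = 0 := hzero a fun c => by
        have := h _ ⟨(0, c), rfl⟩
        rwa [hF, hF, hb, map_zero, LinearMap.zero_apply, LinearMap.zero_apply, add_zero, zero_add,
          hadj, hmul, polar_comm] at this
      rw [hF, ha, hb, LinearMap.zero_apply, LinearMap.zero_apply, add_zero]
    · have : F (1, 0) ∈ LinearMap.range F := ⟨_, rfl⟩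
      rw [h, Submodule.mem_bot, hF] at this
      simpa using this
  refine ⟨u, eq_top_iff.2 ?_⟩
  have hinv := isInvariant_span_pow φ u
  set W := Submodule.span K (Set.range fun k : ℕ => (φ ^ k) u)
  have huW : u ∈ W := Submodule.subset_span ⟨0, rfl⟩
  have hW : ∀ c : K[X], ∀ x ∈ W, aeval y c x ∈ W := by
    intro c
    induction c using Polynomial.induction_on with
    | C r => intro x hx; rw [aeval_C]; exact Submodule.smul_mem _ _ hx
    | add p q hp hq => intro x hx; rw [map_add]; exact add_mem (hp x hx) (hq x hx)
    | monomial n r ih =>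
      intro x hx
      rw [pow_succ, ← mul_assoc, ← hmul, aeval_X]
      exact ih _ (add_mem (hinv x hx) (hinv.symm_apply_mem hx))
  rw [← htop]
  rintro _ ⟨⟨a, b⟩, rfl⟩
  rw [hF]
  exact add_mem (hW a u huW) (hW b _ (hinv u huW))

/-- A noncyclic orthogonally indecomposable isometry is unipotent, and its highest nonzero power of
`φ - 1` is alternating with respect to the polar form. -/
theorem isCyclic_or_alternating [FiniteDimensional K V] [Nontrivial V]
    (hQ : IsNondefective Q) (hφ : φ ∈ orthogonalGroup Q) (hind : IsOrthIndecomposable Q φ) :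
    IsCyclic φ ∨ ∃ k, ((φ : End K V) - 1) ^ (k + 1) = 0 ∧ ((φ : End K V) - 1) ^ k ≠ 0 ∧
      ∀ x, polar Q ((((φ : End K V) - 1) ^ k) x) x = 0 := by
  classical
  have h1 : Commute ((φ : End K V) + (φ.symm : End K V)) (φ : End K V) := by ext x; simp
  rcases isNilpotent_or_injective hQ hind (fun x y => by
    rw [LinearMap.add_apply, LinearMap.add_apply, polar_add_left, polar_add_right]
    simp only [LinearEquiv.coe_coe]
    rw [polar_symm_left hφ, polar_comm Q (φ x), ← polar_symm_left hφ, polar_comm Q _ x,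
      add_comm]) h1 with h | h
  · obtain ⟨k, hk, hk'⟩ : ∃ k, ((φ : End K V) - 1) ^ (k + 1) = 0 ∧
        ((φ : End K V) - 1) ^ k ≠ 0 := by
      have hex : ∃ t, ((φ : End K V) - 1) ^ t = 0 := isUnipotent_of_isNilpotent_add_symm h
      have hpos : Nat.find hex ≠ 0 := by
        intro h
        have := Nat.find_spec hex
        rw [h, pow_zero] at this
        exact one_ne_zero this
      refine ⟨Nat.find hex - 1, ?_, Nat.find_min hex (by omega)⟩
      rw [Nat.sub_add_cancel (by omega)]
      exact Nat.find_spec hex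
    by_cases hB : ∀ x, polar Q ((((φ : End K V) - 1) ^ k) x) x = 0
    · exact .inr ⟨k, hk, hk', hB⟩
    · push Not at hB
      obtain ⟨u, hu⟩ := hB
      refine .inl (isCyclic_of_span_nat (u := u) (span_eq_top_of_gram (u := fun _ : Unit => u)
        hφ hind hk (fun c hc i => ?_) ⟨(), ?_⟩))
      · simpa [hu] using hc ()
      · rintro rfl
        rw [map_zero, polar_zero_right] at hu
        exact hu rfl
  · exact .inl (isCyclic_of_injective_add_symm hQ hφ hind h)

/-- V is the direct sum of the cyclic submodules of v and w when f(N^k v, w) ≠ 0. -/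
theorem not_isIndecomposable_of_alternating [FiniteDimensional K V] (hQ : IsNondefective Q)
    (hφ : φ ∈ orthogonalGroup Q)
    (hind : IsOrthIndecomposable Q φ) {k : ℕ} (hN : ((φ : End K V) - 1) ^ (k + 1) = 0)
    (hN' : ((φ : End K V) - 1) ^ k ≠ 0)
    (hB : ∀ x, polar Q ((((φ : End K V) - 1) ^ k) x) x = 0) : ¬ IsIndecomposable φ := by
  rintro ⟨-, h⟩
  obtain ⟨v, w, hvw, -⟩ := exists_symmetric_pair hQ hφ hN hN' hB 0
  let U : V → Submodule K V := fun x => Submodule.span K (Set.range fun j : ℕ => (φ ^ j) x)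
  have hU : ∀ x, x ∈ U x := fun x => Submodule.subset_span ⟨0, rfl⟩
  have hpoly : ∀ x, ∀ z ∈ U x, ∃ p : K[X], aeval (φ : End K V) p x = z := by
    intro x z hz
    have : U x ≤ LinearMap.range ((LinearMap.applyₗ x) ∘ₗ (aeval (φ : End K V)).toLinearMap) := by
      rw [Submodule.span_le]
      rintro _ ⟨j, rfl⟩
      exact ⟨X ^ j, aeval_X_pow_apply φ j x⟩
    exact this hz
  have hcompl : IsCompl (U v) (U w) := by
    refine ⟨Submodule.disjoint_def.2 fun z hz hz' => ?_, codisjoint_iff.2 (eq_top_iff.2 ?_)⟩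
    · obtain ⟨p, rfl⟩ := hpoly v z hz
      obtain ⟨q, hq⟩ := hpoly w _ hz'
      have hdvd := sub_one_pow_dvd_of_orthogonal (u := fun b => cond b v w) hφ hN
        (gram_pair hB hvw) (fun b => cond b p (-q)) (fun l j => by
          simp [hq, polar_zero_left]) true
      obtain ⟨r, hr⟩ := hdvd
      simp only [cond_true] at hr
      rw [hr, map_mul, aeval_sub_one_pow, hN, zero_mul, LinearMap.zero_apply]
    · rw [← span_nat_pair hφ hind hN hB hvw, Submodule.span_le]
      rintro _ ⟨⟨b, j⟩, rfl⟩
      cases b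
      · exact Submodule.mem_sup_right (Submodule.subset_span ⟨j, rfl⟩)
      · exact Submodule.mem_sup_left (Submodule.subset_span ⟨j, rfl⟩)
  rcases h _ _ (isInvariant_span_pow φ v) (isInvariant_span_pow φ w) hcompl with h | h
  · have hv := hU v
    change v ∈ Submodule.span K _ at hv
    rw [h, Submodule.mem_bot] at hv
    rw [hv, map_zero, polar_zero_left] at hvw
    exact hvw rfl
  · have hw := hU w
    change w ∈ Submodule.span K _ at hw
    rw [h, Submodule.mem_bot] at hw
    rw [hw, polar_zero_right] at hvw
    exact hvw rfl

end

theorem natDegree_minpoly_of_sub_one_pow {φ : V ≃ₗ[K] V} {k : ℕ}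
    (hN : ((φ : End K V) - 1) ^ (k + 1) = 0) (hN' : ((φ : End K V) - 1) ^ k ≠ 0) :
    (minpoly K (φ : End K V)).natDegree = k + 1 := by
  have hprime : Prime (X - 1 : K[X]) := by
    rw [← C_1]; exact prime_X_sub_C 1
  obtain ⟨i, hi, h⟩ := (dvd_prime_pow hprime (k + 1)).1
    (minpoly.dvd K (φ : End K V) (p := (X - 1) ^ (k + 1)) (by rw [aeval_sub_one_pow, hN]))
  rw [natDegree_eq_of_degree_eq (degree_eq_degree_of_associated h), natDegree_sub_one_pow]
  refine le_antisymm hi (Nat.succ_le_of_lt (lt_of_not_ge fun hik => hN' ?_))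
  obtain ⟨r, hr⟩ := h.dvd.trans (pow_dvd_pow _ hik)
  rw [← aeval_sub_one_pow, hr, map_mul, minpoly.aeval, zero_mul]

end QuadraticSpace

open QuadraticSpace in
theorem proposition4p1 {K V : Type*} [Field K] [CharP K 2] [AddCommGroup V] [Module K V]
    [FiniteDimensional K V] (Q : QuadraticForm K V) (hQ : IsNondefective Q)
    (φ : V ≃ₗ[K] V) (hφ : φ ∈ orthogonalGroup Q) (hind : IsOrthIndecomposable Q φ) :
    (∃ σ ∈ orthogonalGroup Q, IsInvolution σ ∧ Inverts σ φ ∧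
      2 * Module.finrank K (fix σ) = Module.finrank K V) ∧
    -- `σ * φ` applies `φ` first; with maps acting on the right it is written `φσ`
    (IsCyclic φ → ∀ σ ∈ orthogonalGroup Q, IsInvolution σ → Inverts σ φ →
      fix φ = fix σ ⊓ fix (σ * φ)) ∧
    ((IsType1o Q φ ∨ IsType2 Q φ) → IsUnipotent φ →
      ∃ ρ ∈ orthogonalGroup Q, ∃ σ ∈ orthogonalGroup Q,
        (IsInvolution ρ ∧ Inverts ρ φ ∧
          2 * Module.finrank K (fix ρ) = Module.finrank K V) ∧
        (IsInvolution σ ∧ Inverts σ φ ∧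
          2 * Module.finrank K (fix σ) = Module.finrank K V + 2)) := by
  have half : ∃ σ ∈ orthogonalGroup Q, IsInvolution σ ∧ Inverts σ φ ∧
      2 * Module.finrank K (fix σ) = Module.finrank K V := by
    rcases subsingleton_or_nontrivial V with hV | hV
    · exact IsCyclic.exists_involution_half hQ hφ ⟨0, Subsingleton.elim _ _⟩
    rcases isCyclic_or_alternating hQ hφ hind with hc | ⟨k, hN, hN', hB⟩
    · exact hc.exists_involution_half hQ hφ
    obtain ⟨n, rfl | rfl⟩ := Nat.even_or_odd' k
    · exact exists_swap_involution hQ hφ hind hN hN' hB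
    · have := exists_diagonal_involution hQ hφ hind hN hN' hB
      rwa [show (2 * n + 1 + 1) % 2 = 0 by omega] at this
  refine ⟨half, fun hc σ _ hσ hσφ => hc.fix_eq_inf hQ hφ hσ hσφ, fun htype hu => ?_⟩
  obtain ⟨ρ, hρ, hρ'⟩ := half
  refine ⟨ρ, hρ, ?_⟩
  rcases htype with ⟨-, hodd⟩ | ⟨-, hindec⟩
  · have hnc : ¬ IsCyclic φ := fun hc => by
      rw [hc.natDegree_minpoly] at hodd
      exact Nat.not_even_iff_odd.2 hodd hQ.even_finrank
    have hV : Nontrivial V := by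
      by_contra hV
      rw [not_nontrivial_iff_subsingleton] at hV
      exact hnc ⟨0, Subsingleton.elim _ _⟩
    obtain ⟨k, hN, hN', hB⟩ := (isCyclic_or_alternating hQ hφ hind).resolve_left hnc
    rw [natDegree_minpoly_of_sub_one_pow hN hN'] at hodd
    obtain ⟨σ, hσ, h1, h2, h3⟩ := exists_diagonal_involution hQ hφ hind hN hN' hB
    rw [Nat.odd_iff.1 hodd] at h3
    exact ⟨σ, hσ, hρ', h1, h2, h3⟩
  · have hV : Nontrivial V := hindec.1
    rcases isCyclic_or_alternating hQ hφ hind with hc | ⟨k, hN, hN', hB⟩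
    · obtain ⟨σ, hσ, h⟩ := hc.exists_involution_half_add_one hQ hφ hu
      exact ⟨σ, hσ, hρ', h⟩
    · exact absurd hindec (not_isIndecomposable_of_alternating hQ hφ hind hN hN' hB)
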